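/- Let $R>0$ and $\lambda>1$ be real numbers and let $(\alpha_n)_{n\ge 1}$ be a sequence of real numbers with $\lim_{n\to\infty}\alpha_n/n=\lambda$. Let $\rho$ be the uniform probability distribution on the disc $\{z\in\mathbb{C}:|z|\le R\}$, let $U_\rho(x)=-\int\log|x-y|\,\mathrm{d}\rho(y)$, and put $V_n=-\frac{\alpha_n}{n}U_\rho$ and $$E_n(x_1,\dots,x_n)=-\sum_{1\le i<j\le n}\log|x_i-x_j|+n\sum_{i=1}^nV_n(x_i),\qquad Z_n=\int_{\mathbb{C}^n}\mathrm{e}^{-2E_n(x_1,\dots,x_n)}\,\mathrm{d}x_1\cdots\mathrm{d}x_n,$$ where the integral is with respect to Lebesgue measure on $\mathbb{C}^n$. Then for all $n$ large enough $Z_n<\infty$, and $$\mathrm{d}P_n(x_1,\dots,x_n)=\frac{\mathrm{e}^{-2E_n(x_1,\dots,x_n)}}{Z_n}\,\mathrm{d}x_1\cdots\mathrm{d}x_n$$ is a well-defined probability measure on $\mathbb{C}^n$ (the planar Coulomb gas with uniform background at inverse temperature $\beta=2$). Moreover, for every sequence of random vectors $X_n=(X_{n,1},\dots,X_{n,n})$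 with values in $\mathbb{C}^n$ such that $X_n$ has law $P_n$ for all $n$ large enough, if we set $$c_n=\log n-2\log\log n-\log(2\pi),\quad C_n=R\sqrt{\frac{n}{\alpha_n}},\quad a_n=\frac{2\sqrt{n c_n}}{C_n},\quad b_n=C_n\Bigl(1+\frac12\sqrt{\frac{c_n}{n}}\Bigr)$$ (which is meaningful for $n$ large enough), then, as $n\to\infty$, $$\max_{1\le k\le n}|X_{n,k}|\longrightarrow\frac{R}{\sqrt{\lambda}}\ \text{ in probability, and }\quad a_n\Bigl(\max_{1\le k\le n}|X_{n,k}|-b_n\Bigr)\longrightarrow G\ \text{ in law},$$ where $G$ is the Gumbel law, with cumulative distribution function $t\mapsto\mathrm{e}^{-\mathrm{e}^{-t}}$, $t\in\mathbb{R}$. -/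

import Mathlib

open MeasureTheory ProbabilityTheory Filter Topology

noncomputable section

namespace Jellium

/-- The planar Coulomb kernel `g = -log |·|`. The kernel is defined off the origin; at the origin
`Real.log 0 = 0` gives the value `0`, which affects neither the potentials of absolutely
continuous measures nor the Gibbs measures below, since it matters only on Lebesgue null sets. -/
def coulombKernel (z : ℂ) : ℝ := -Real.log ‖z‖

/-- The Coulomb (logarithmic) potential `U_μ(x) = ∫ g(x - y) dμ(y)`. -/
def coulombPotential (μ : Measure ℂ) (x : ℂ) : ℝ := ∫ y, coulombKernel (x - y) ∂μ

/-- The uniform probability distribution on the closed disc of radius `R` centered at `0`. -/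
def uniformDisc (R : ℝ) : Measure ℂ := ProbabilityTheory.cond volume (Metric.closedBall (0 : ℂ) R)

/-- The energy `E_n(x) = ∑_{i<j} g(x_i - x_j) + n ∑_i V(x_i)` of `n` particles in the external
potential `V`. -/
def energy (n : ℕ) (V : ℂ → ℝ) (x : Fin n → ℂ) : ℝ :=
  ∑ i : Fin n, ∑ j ∈ Finset.Ioi i, coulombKernel (x i - x j) + (n : ℝ) * ∑ i : Fin n, V (x i)

/-- The Boltzmann weight `exp (-β E_n(x))`. -/
def gibbsWeight (β : ℝ) (n : ℕ) (V : ℂ → ℝ) (x : Fin n → ℂ) : ENNReal :=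
  ENNReal.ofReal (Real.exp (-(β * energy n V x)))

/-- The partition function `Z_n`, an element of `[0, ∞]`. -/
def partitionFunction (β : ℝ) (n : ℕ) (V : ℂ → ℝ) : ENNReal :=
  ∫⁻ x : Fin n → ℂ, gibbsWeight β n V x

/-- The Coulomb gas on `ℂⁿ`, with density `exp (-β E_n) / Z_n` with respect to Lebesgue measure. -/
def coulombGas (β : ℝ) (n : ℕ) (V : ℂ → ℝ) : Measure (Fin n → ℂ) :=
  (partitionFunction β n V)⁻¹ • (volume.withDensity (gibbsWeight β n V))

/-- The external potential `V = -(α/n) U_ρ` generated by a background of total charge `α` and of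
opposite sign, spread uniformly (`ρ`) on the disc of radius `R`. -/
def jelliumPotential (R α : ℝ) (n : ℕ) (x : ℂ) : ℝ :=
  -(α / n) * coulombPotential (uniformDisc R) x

/-- The distribution function `t ↦ exp (-exp (-t))` of the Gumbel law. -/
def gumbelCDF : StieltjesFunction ℝ where
  toFun t := Real.exp (-Real.exp (-t))
  mono' := fun s t h => by
    apply Real.exp_le_exp.2
    apply neg_le_neg
    apply Real.exp_le_exp.2
    linarith
  right_continuous' := fun x =>
    (show Continuous fun t : ℝ => Real.exp (-Real.exp (-t)) by fun_prop).continuousWithinAt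

/-- The Gumbel law on `ℝ`. -/
def gumbelLaw : Measure ℝ := gumbelCDF.measure

lemma gumbelCDF_apply (t : ℝ) : gumbelCDF t = Real.exp (-Real.exp (-t)) := rfl

lemma tendsto_gumbelCDF_atBot : Tendsto gumbelCDF atBot (𝓝 0) :=
  Real.tendsto_exp_neg_atTop_nhds_zero.comp (Real.tendsto_exp_atTop.comp tendsto_neg_atBot_atTop)

lemma tendsto_gumbelCDF_atTop : Tendsto gumbelCDF atTop (𝓝 1) := by
  have h : Tendsto (fun t : ℝ => Real.exp (-Real.exp (-t))) atTop (𝓝 (Real.exp (-0))) :=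
    (Real.continuous_exp.tendsto _).comp Real.tendsto_exp_neg_atTop_nhds_zero.neg
  rw [neg_zero, Real.exp_zero] at h
  exact h

instance gumbelLaw_isProbabilityMeasure : IsProbabilityMeasure gumbelLaw :=
  gumbelCDF.isProbabilityMeasure tendsto_gumbelCDF_atBot tendsto_gumbelCDF_atTop

lemma gumbelLaw_Iic (t : ℝ) :
    gumbelLaw (Set.Iic t) = ENNReal.ofReal (Real.exp (-Real.exp (-t))) := by
  rw [gumbelLaw, gumbelCDF.measure_Iic tendsto_gumbelCDF_atBot, sub_zero, gumbelCDF_apply]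

/-- `c_n = log n - 2 log log n - log (2π)`. -/
def edgeC (n : ℕ) : ℝ :=
  Real.log n - 2 * Real.log (Real.log n) - Real.log (2 * Real.pi)

/-- `C_n = R √(n / α_n)`. -/
def edgeRadius (R α : ℝ) (n : ℕ) : ℝ := √(n / α) * R

/-- `a_n = 2 √(n c_n) / C_n`. -/
def edgeScale (R α : ℝ) (n : ℕ) : ℝ := 2 * √(n * edgeC n) / edgeRadius R α n

/-- `b_n = C_n (1 + (1/2) √(c_n / n))`. -/
def edgeCenter (R α : ℝ) (n : ℕ) : ℝ :=
  edgeRadius R α n * (1 + 1 / 2 * √(edgeC n / n))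

/-- The modulus `max_k |x_k|` of the farthest particle (for `n ≥ 1`). -/
def maxModulus {n : ℕ} (x : Fin n → ℂ) : ℝ := ⨆ k : Fin n, ‖x k‖

end Jellium

end

noncomputable section

namespace Jellium

/-! At `β = 2` with a radial potential the density is a squared Vandermonde modulus times a product
of radial weights. Monomials are orthogonal for such weights, so expanding the determinant collapses
the integral to `n!` times a product of moments (`integral_prod_norm_sub_sq_radial`). Applied with
and without truncation, this writes the law of the farthest particle as a product over the degrees
`k < n` (`coulombGas_maxModulus_le`).

The background potential is quadratic inside the disc and logarithmic outside. For `r ≤ R` the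
truncated moments are therefore incomplete Gamma integrals, giving factors `1 - Q_k(s)` with `s = α
r² / R²` and `Q_k` the Poisson distribution function. Since `λ > 1`, the edge `R / √λ` lies strictly
inside the disc, and the normalising factors differ from `1` by exponentially small amounts
(`tendsto_prod_normalisation`).

At the Gumbel level, `s = n (1 + x)` with `n x² = c_n + 2t + o(1)`. Put `q = n / s`. Below `n` the
Poisson masses decay nearly geometrically with ratio `q`, so `∑ Q_k(s)` is asymptotic to (mass at
`n`) `/ (1 - q)²`. The largest `Q_k` tends to `0`, so the product behaves like the exponential of
minus that sum (`tendsto_prod_one_sub_poissonCDF`). Stirling's formula and the choice of `c_n` make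
the sum converge to `e^{-t}` (`tendsto_prod_one_sub_poissonCDF_edge`). Both modes of convergence
then follow from distribution functions. -/

/-! ### Logarithmic potential of the uniform disc. -/

lemma lintegral_closedBall_polar (F : ℂ → ENNReal) (hF : Measurable F) (R : ℝ) :
    ∫⁻ y in Metric.closedBall (0 : ℂ) R, F y = ∫⁻ r in Set.Ioc 0 R,
      ENNReal.ofReal r * ∫⁻ θ in Set.Ioo (-Real.pi) Real.pi, F (circleMap 0 r θ) := by
  rw [← lintegral_indicator Metric.isClosed_closedBall.measurableSet,
    ← Complex.lintegral_comp_polarCoord_symm]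
  have hsymm : ∀ p : ℝ × ℝ, Complex.polarCoord.symm p = circleMap 0 p.1 p.2 := fun p => by
    rw [Complex.polarCoord_symm_apply, circleMap_zero, Complex.exp_mul_I, Complex.ofReal_cos,
      Complex.ofReal_sin]
  simp_rw [hsymm]
  have hcm : Measurable fun p : ℝ × ℝ => circleMap 0 p.1 p.2 := by
    unfold circleMap; fun_prop
  rw [polarCoord_target, Measure.volume_eq_prod, ← Measure.prod_restrict, lintegral_prod]
  · rw [← Set.Ioi_inter_Iic, ← Measure.restrict_restrict_of_subset (s := Set.Ioi (0:ℝ) ∩ Set.Iic R)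
      (t := Set.Ioi 0) Set.inter_subset_left, ← lintegral_indicator (measurableSet_Ioi.inter measurableSet_Iic)]
    refine setLIntegral_congr_fun measurableSet_Ioi fun r hr => ?_
    have hr : 0 < r := hr
    by_cases h : r ≤ R
    · rw [Set.indicator_of_mem (by exact ⟨hr, h⟩), ← lintegral_const_mul]
      · refine lintegral_congr fun θ => ?_
        rw [Set.indicator_of_mem, smul_eq_mul]
        simp [abs_of_pos hr, h]
      · exact hF.comp (by unfold circleMap; fun_prop)
    · rw [Set.indicator_of_notMem (fun h' => h h'.2)]
      refine (lintegral_congr fun θ => ?_).trans lintegral_zero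
      rw [Set.indicator_of_notMem, smul_zero]
      simpa [abs_of_pos hr] using h
  · refine Measurable.aemeasurable ?_
    refine (ENNReal.measurable_ofReal.comp measurable_fst).smul ?_
    exact (hF.indicator Metric.isClosed_closedBall.measurableSet).comp hcm

lemma lintegral_circleMap (f : ℂ → ℝ) (r : ℝ) (hf : CircleIntegrable f 0 r)
    (h0 : ∀ θ, 0 ≤ f (circleMap 0 r θ)) :
    ∫⁻ θ in Set.Ioo (-Real.pi) Real.pi, ENNReal.ofReal (f (circleMap 0 r θ)) =
      ENNReal.ofReal (2 * Real.pi * Real.circleAverage f 0 r) := by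
  -- The polar chart uses angles in `(-π, π)`, circle averages use `[0, 2π]`; periodicity identifies
  -- the two.
  have hper : Function.Periodic (fun θ => f (circleMap 0 r θ)) (2 * Real.pi) := fun θ => by
    simp only [periodic_circleMap 0 r θ]
  have hint : IntervalIntegrable (fun θ => f (circleMap 0 r θ)) volume (-Real.pi) Real.pi :=
    hper.intervalIntegrable₀ Real.two_pi_pos.ne' hf _ _
  rw [← ofReal_integral_eq_lintegral_ofReal
    ((intervalIntegrable_iff_integrableOn_Ioo_of_le (by linarith [Real.pi_pos])).1 hint)
    (ae_of_all _ h0), Real.circleAverage_def, smul_eq_mul, mul_inv_cancel_left₀ Real.two_pi_pos.ne']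
  congr 1
  rw [← integral_Ioc_eq_integral_Ioo, ← intervalIntegral.integral_of_le (by linarith [Real.pi_pos])]
  have := hper.intervalIntegral_add_eq (-Real.pi) 0
  rw [zero_add] at this
  rw [← this]
  congr 1
  ring

lemma circleIntegrable_log_norm_sub (x : ℂ) (r : ℝ) :
    CircleIntegrable (fun y => Real.log ‖x - y‖) 0 r := by
  simp_rw [norm_sub_rev x]
  exact MeromorphicOn.circleIntegrable_log_norm (fun _ _ ↦ by fun_prop)

/-- Newton's theorem in the plane: a uniformly charged circle acts outside like a point charge at
its centre, and its potential is constant inside. -/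
lemma circleAverage_log_norm_sub (x : ℂ) {r : ℝ} (hr : 0 < r) :
    Real.circleAverage (fun y => Real.log ‖x - y‖) 0 r = Real.log (max r ‖x‖) := by
  simp_rw [norm_sub_rev x]
  rw [circleAverage_log_norm_sub_const_eq_log_radius_add_posLog hr.ne', zero_sub, norm_neg]
  rcases le_total r ‖x‖ with h | h
  · have hx : 0 < ‖x‖ := hr.trans_le h
    rw [max_eq_right h, Real.posLog_eq_log, Real.log_mul (by positivity) (by positivity),
      Real.log_inv]
    · ring
    · rw [abs_of_nonneg (by positivity), inv_mul_eq_div, one_le_div hr]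
      exact h
  · rw [max_eq_left h, (Real.posLog_eq_zero_iff _).2, add_zero]
    rw [abs_of_nonneg (by positivity), inv_mul_eq_div]
    exact div_le_one_of_le₀ h hr.le

/-- The logarithm is integrable on discs, and its integral is computed in polar coordinates. -/
lemma integral_log_norm_sub_closedBall (x : ℂ) {R : ℝ} (hR : 0 < R) :
    IntegrableOn (fun y => Real.log ‖x - y‖) (Metric.closedBall 0 R) ∧
    ∫ y in Metric.closedBall (0 : ℂ) R, Real.log ‖x - y‖ =
      ∫ r in (0 : ℝ)..R, 2 * Real.pi * (r * Real.log (max r ‖x‖)) := by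
  -- Subtracting from `log M` gives a nonnegative integrand on the disc. The computation can then be
  -- done with lower integrals, and integrability follows from finiteness.
  set M : ℝ := ‖x‖ + R + 1 with hM
  have hM1 : 1 ≤ M := by linarith [norm_nonneg x]
  have hpos : ∀ y ∈ Metric.closedBall (0 : ℂ) R, 0 ≤ Real.log M - Real.log ‖x - y‖ := by
    intro y hy
    rw [mem_closedBall_zero_iff] at hy
    rcases eq_or_ne (x - y) 0 with h | h
    · rw [h, norm_zero, Real.log_zero, sub_zero]; exact Real.log_nonneg hM1
    · exact sub_nonneg.2 (Real.log_le_log (norm_pos_iff.2 h) (by linarith [norm_sub_le x y]))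
  have hmeas : Measurable fun y => Real.log M - Real.log ‖x - y‖ := by fun_prop
  -- Only `x = 0` is delicate: there the function is `u * log u` at `u = max r 0`, continuous
  -- because `Real.log 0 = 0`.
  have hcont : Continuous fun r : ℝ => r * Real.log (max r ‖x‖) := by
    rcases (norm_nonneg x).eq_or_lt with h | h
    · have : (fun r : ℝ => r * Real.log (max r ‖x‖)) =
          fun r => max r 0 * Real.log (max r 0) := by
        funext r
        rw [← h]
        rcases le_total r 0 with hr | hr
        · simp [max_eq_right hr]
        · simp [max_eq_left hr]
      rw [this]
      exact Real.continuous_mul_log.comp (by fun_prop)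
    · exact continuous_id.mul ((continuous_id.max continuous_const).log
        fun r => (lt_max_of_lt_right h).ne')
  have hnn : ∀ r ∈ Set.Ioc 0 R,
      0 ≤ 2 * Real.pi * (r * (Real.log M - Real.log (max r ‖x‖))) := by
    intro r hr
    have : Real.log (max r ‖x‖) ≤ Real.log M :=
      Real.log_le_log (lt_max_of_lt_left hr.1)
        (max_le (by linarith [hr.2, norm_nonneg x]) (by linarith))
    have := Real.pi_pos
    exact mul_nonneg (by positivity) (mul_nonneg hr.1.le (by linarith))
  have hii : ∀ a b : ℝ, IntervalIntegrable
      (fun r : ℝ => 2 * Real.pi * (r * (Real.log M - Real.log (max r ‖x‖)))) volume a b := by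
    intro a b
    refine Continuous.intervalIntegrable ?_ a b
    simp_rw [mul_sub]
    fun_prop
  have key : ∫⁻ y in Metric.closedBall (0 : ℂ) R, ENNReal.ofReal (Real.log M - Real.log ‖x - y‖) =
      ENNReal.ofReal (∫ r in (0 : ℝ)..R,
        2 * Real.pi * (r * (Real.log M - Real.log (max r ‖x‖)))) := by
    rw [lintegral_closedBall_polar _ (by fun_prop), intervalIntegral.integral_of_le hR.le,
      ofReal_integral_eq_lintegral_ofReal]
    · refine setLIntegral_congr_fun measurableSet_Ioc fun r hr => ?_
      rw [lintegral_circleMap (fun y => Real.log M - Real.log ‖x - y‖) r,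
        ← ENNReal.ofReal_mul hr.1.le]
      · congr 1
        rw [show (fun y => Real.log M - Real.log ‖x - y‖) =
          (fun _ => Real.log M) - fun y => Real.log ‖x - y‖ from rfl,
          Real.circleAverage_sub (circleIntegrable_const _ _ _)
          (circleIntegrable_log_norm_sub x r), Real.circleAverage_const,
          circleAverage_log_norm_sub x hr.1]
        ring
      · exact (circleIntegrable_const _ _ _).sub (circleIntegrable_log_norm_sub x r)
      · intro θ
        refine hpos _ ?_
        rw [mem_closedBall_zero_iff, norm_circleMap_zero, abs_of_pos hr.1]
        exact hr.2
    · exact (hii 0 R).1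
    · exact (ae_restrict_mem measurableSet_Ioc).mono hnn
  have hint : IntegrableOn (fun y => Real.log M - Real.log ‖x - y‖) (Metric.closedBall 0 R) := by
    refine ⟨hmeas.aestronglyMeasurable, ?_⟩
    rw [hasFiniteIntegral_iff_ofReal
      ((ae_restrict_mem Metric.isClosed_closedBall.measurableSet).mono hpos), key]
    exact ENNReal.ofReal_lt_top
  have hcst : IntegrableOn (fun _ : ℂ => Real.log M) (Metric.closedBall 0 R) :=
    integrableOn_const (by exact measure_closedBall_lt_top.ne)
  have hlog : IntegrableOn (fun y => Real.log ‖x - y‖) (Metric.closedBall 0 R) := by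
    refine (hcst.sub hint).congr (ae_of_all _ fun y => ?_)
    simp
  refine ⟨hlog, ?_⟩
  have h1 : ∫ y in Metric.closedBall (0 : ℂ) R, (Real.log M - Real.log ‖x - y‖) =
      ∫ r in (0 : ℝ)..R, 2 * Real.pi * (r * (Real.log M - Real.log (max r ‖x‖))) := by
    rw [integral_eq_lintegral_of_nonneg_ae
      ((ae_restrict_mem Metric.isClosed_closedBall.measurableSet).mono hpos)
      hmeas.aestronglyMeasurable, key, ENNReal.toReal_ofReal]
    rw [intervalIntegral.integral_of_le hR.le]
    exact setIntegral_nonneg measurableSet_Ioc hnn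
  rw [integral_sub hcst hlog] at h1
  have h2 : ∫ y in Metric.closedBall (0 : ℂ) R, Real.log M = Real.pi * R ^ 2 * Real.log M := by
    rw [setIntegral_const, smul_eq_mul, measureReal_def, Complex.volume_closedBall]
    simp only [ENNReal.toReal_mul, ENNReal.toReal_pow, ENNReal.toReal_ofReal hR.le,
      ENNReal.coe_toReal, NNReal.coe_real_pi]
    ring
  have h3 : ∫ r in (0 : ℝ)..R, 2 * Real.pi * (r * (Real.log M - Real.log (max r ‖x‖))) =
      Real.pi * R ^ 2 * Real.log M - ∫ r in (0 : ℝ)..R, 2 * Real.pi * (r * Real.log (max r ‖x‖)) := by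
    simp_rw [mul_sub]
    rw [intervalIntegral.integral_sub (Continuous.intervalIntegrable (by fun_prop) _ _)
      (Continuous.intervalIntegrable (by fun_prop) _ _), intervalIntegral.integral_const_mul,
      intervalIntegral.integral_mul_const, integral_id]
    ring
  linarith

lemma coulombPotential_uniformDisc (x : ℂ) {R : ℝ} (hR : 0 < R) :
    coulombPotential (uniformDisc R) x =
      -((2 / R ^ 2) * ∫ r in (0 : ℝ)..R, r * Real.log (max r ‖x‖)) := by
  unfold coulombPotential uniformDisc coulombKernel
  rw [ProbabilityTheory.cond, integral_smul_measure, integral_neg,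
    (integral_log_norm_sub_closedBall x hR).2, intervalIntegral.integral_const_mul,
    Complex.volume_closedBall]
  simp only [smul_eq_mul, ENNReal.toReal_inv, ENNReal.toReal_mul, ENNReal.toReal_pow,
    ENNReal.toReal_ofReal hR.le, ENNReal.coe_toReal, NNReal.coe_real_pi]
  have := Real.pi_pos
  field_simp

lemma coulombPotential_uniformDisc_of_le {x : ℂ} {R : ℝ} (hR : 0 < R) (h : R ≤ ‖x‖) :
    coulombPotential (uniformDisc R) x = -Real.log ‖x‖ := by
  have : ∫ r in (0 : ℝ)..R, r * Real.log (max r ‖x‖) = ∫ r in (0 : ℝ)..R, r * Real.log ‖x‖ := by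
    refine intervalIntegral.integral_congr fun r hr => ?_
    rw [Set.uIcc_of_le hR.le] at hr
    rw [max_eq_right (hr.2.trans h)]
  rw [coulombPotential_uniformDisc x hR, this, intervalIntegral.integral_mul_const, integral_id]
  field_simp
  ring

lemma integral_mul_log {a b : ℝ} (ha : 0 ≤ a) (hab : a ≤ b) :
    ∫ r in a..b, r * Real.log r =
      b ^ 2 * Real.log b / 2 - b ^ 2 / 4 - (a ^ 2 * Real.log a / 2 - a ^ 2 / 4) := by
  have hc : Continuous fun r : ℝ => r ^ 2 * Real.log r / 2 - r ^ 2 / 4 := by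
    have : (fun r : ℝ => r ^ 2 * Real.log r / 2 - r ^ 2 / 4) =
        fun r => r * (r * Real.log r) / 2 - r ^ 2 / 4 := by
      funext r; ring
    rw [this]
    have := Real.continuous_mul_log
    fun_prop
  refine intervalIntegral.integral_eq_sub_of_hasDerivAt_of_le hab hc.continuousOn ?_
    (Real.continuous_mul_log.intervalIntegrable _ _)
  intro r hr
  have hr0 : r ≠ 0 := (ha.trans_lt hr.1).ne'
  have := (((hasDerivAt_pow 2 r).mul (Real.hasDerivAt_log hr0)).div_const 2).sub
    ((hasDerivAt_pow 2 r).div_const 4)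
  refine this.congr_deriv ?_
  field_simp
  ring

lemma coulombPotential_uniformDisc_of_ge {x : ℂ} {R : ℝ} (hR : 0 < R) (h : ‖x‖ ≤ R) :
    coulombPotential (uniformDisc R) x = -Real.log R + (1 - ‖x‖ ^ 2 / R ^ 2) / 2 := by
  have h1 : Set.EqOn (fun r => r * Real.log (max r ‖x‖)) (fun r => r * Real.log ‖x‖)
      (Set.uIcc 0 ‖x‖) := by
    intro r hr
    rw [Set.uIcc_of_le (norm_nonneg x)] at hr
    simp only
    rw [max_eq_right hr.2]
  have h2 : Set.EqOn (fun r => r * Real.log (max r ‖x‖)) (fun r => r * Real.log r)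
      (Set.uIcc ‖x‖ R) := by
    intro r hr
    rw [Set.uIcc_of_le h] at hr
    simp only
    rw [max_eq_left hr.1]
  have i1 : IntervalIntegrable (fun r => r * Real.log (max r ‖x‖)) volume 0 ‖x‖ :=
    (Continuous.intervalIntegrable (u := fun r => r * Real.log ‖x‖) (by fun_prop) 0 ‖x‖).congr
      (h1.symm.mono Set.uIoc_subset_uIcc)
  have i2 : IntervalIntegrable (fun r => r * Real.log (max r ‖x‖)) volume ‖x‖ R :=
    (Real.continuous_mul_log.intervalIntegrable ‖x‖ R).congr
      (h2.symm.mono Set.uIoc_subset_uIcc)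
  rw [coulombPotential_uniformDisc x hR, ← intervalIntegral.integral_add_adjacent_intervals i1 i2,
    intervalIntegral.integral_congr h1, intervalIntegral.integral_congr h2,
    intervalIntegral.integral_mul_const, integral_id, integral_mul_log (norm_nonneg x) h]
  field_simp
  ring

/-! ### Orthogonality of monomials and the squared Vandermonde determinant. -/

/-- Monomials of different degrees are orthogonal for any rotation invariant weight. -/
lemma integral_pow_mul_conj_pow_radial (g : ℝ → ℝ) {a b : ℕ} (hab : a ≠ b) :
    ∫ z : ℂ, z ^ a * (starRingEnd ℂ z) ^ b * (g ‖z‖ : ℂ) = 0 := by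
  -- Rotating by `u` multiplies the integral by `u ^ (a - b)`. The angle `π / (a - b)` makes this
  -- factor `-1`, so the integral vanishes, with no integrability needed.
  obtain ⟨u, hu⟩ : ∃ u : Circle, (u : ℂ) ^ a * (starRingEnd ℂ (u : ℂ)) ^ b ≠ 1 := by
    have hd : ((a : ℝ) - b) ≠ 0 := sub_ne_zero.2 (by exact_mod_cast hab)
    refine ⟨Circle.exp (Real.pi / (a - b)), ?_⟩
    have : (starRingEnd ℂ (Circle.exp (Real.pi / (a - b)) : ℂ)) =
        (Circle.exp (-(Real.pi / (a - b))) : ℂ) := by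
      rw [Circle.exp_neg, Circle.coe_inv_eq_conj]
    rw [this, Circle.coe_exp, Circle.coe_exp, ← Complex.exp_nat_mul, ← Complex.exp_nat_mul,
      ← Complex.exp_add]
    have : (a : ℂ) * (((Real.pi / (a - b) : ℝ) : ℂ) * Complex.I) +
        b * (((-(Real.pi / (a - b)) : ℝ) : ℂ) * Complex.I) = Real.pi * Complex.I := by
      have hd' : ((a : ℂ) - b) ≠ 0 := by exact_mod_cast hd
      push_cast
      field_simp
      ring
    rw [this, Complex.exp_pi_mul_I]
    norm_num
  have h := (rotation u).measurePreserving.integral_comp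
    (rotation u).toHomeomorph.measurableEmbedding
    (fun z : ℂ => z ^ a * (starRingEnd ℂ z) ^ b * (g ‖z‖ : ℂ))
  simp only [rotation_apply, map_mul, mul_pow, norm_mul, Circle.norm_coe, one_mul] at h
  have h' : (u : ℂ) ^ a * (starRingEnd ℂ (u : ℂ)) ^ b *
      ∫ z : ℂ, z ^ a * (starRingEnd ℂ z) ^ b * (g ‖z‖ : ℂ) =
      ∫ z : ℂ, z ^ a * (starRingEnd ℂ z) ^ b * (g ‖z‖ : ℂ) := by
    rw [← integral_const_mul]
    refine Eq.trans (integral_congr_ae (ae_of_all _ fun z => ?_)) h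
    simp only
    ring
  by_contra hne
  exact hu (mul_right_cancel₀ hne (h'.trans (one_mul _).symm))

/-- By the arithmetic-geometric mean inequality, mixed moments are dominated by the two even
moments. -/
lemma integrable_pow_mul_conj_pow_radial {g : ℝ → ℝ} (hg : Measurable g) (hg0 : ∀ r, 0 ≤ g r)
    {a b : ℕ} (ha : Integrable fun z : ℂ => ‖z‖ ^ (2 * a) * g ‖z‖)
    (hb : Integrable fun z : ℂ => ‖z‖ ^ (2 * b) * g ‖z‖) :
    Integrable fun z : ℂ => z ^ a * (starRingEnd ℂ z) ^ b * (g ‖z‖ : ℂ) := by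
  refine (ha.add hb).mono' ?_ (ae_of_all _ fun z => ?_)
  · refine Measurable.aestronglyMeasurable ?_
    fun_prop
  · rw [norm_mul, norm_mul, norm_pow, norm_pow, RCLike.norm_conj, Complex.norm_real,
      Real.norm_of_nonneg (hg0 _), Pi.add_apply, ← add_mul]
    refine mul_le_mul_of_nonneg_right ?_ (hg0 _)
    rw [pow_mul', pow_mul']
    nlinarith [sq_nonneg (‖z‖ ^ a - ‖z‖ ^ b), sq_nonneg (‖z‖ ^ a + ‖z‖ ^ b)]

lemma prod_norm_sub_sq_eq_sum {n : ℕ} (x : Fin n → ℂ) :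
    ((∏ i : Fin n, ∏ j ∈ Finset.Ioi i, ‖x i - x j‖ ^ 2 : ℝ) : ℂ) =
      ∑ σ : Equiv.Perm (Fin n), ∑ τ : Equiv.Perm (Fin n),
        ((Equiv.Perm.sign σ : ℤ) : ℂ) * ((Equiv.Perm.sign τ : ℤ) : ℂ) *
          ∏ i, (x i ^ (σ i : ℕ) * (starRingEnd ℂ (x i)) ^ (τ i : ℕ)) := by
  -- Transposing makes the Leibniz formula permute the exponents while each point `x i` keeps its
  -- own factor.
  have h1 : ((∏ i : Fin n, ∏ j ∈ Finset.Ioi i, ‖x i - x j‖ ^ 2 : ℝ) : ℂ) =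
      (Matrix.vandermonde x).transpose.det *
        starRingEnd ℂ (Matrix.vandermonde x).transpose.det := by
    rw [Matrix.det_transpose, Matrix.det_vandermonde, map_prod, ← Finset.prod_mul_distrib]
    push_cast
    refine Finset.prod_congr rfl fun i _ => ?_
    rw [map_prod, ← Finset.prod_mul_distrib]
    refine Finset.prod_congr rfl fun j _ => ?_
    rw [norm_sub_rev, Complex.mul_conj, Complex.normSq_eq_norm_sq]
    push_cast
    rfl
  rw [h1, Matrix.det_apply', map_sum, Finset.sum_mul_sum]
  refine Finset.sum_congr rfl fun σ _ => Finset.sum_congr rfl fun τ _ => ?_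
  simp only [Matrix.transpose_apply, Matrix.vandermonde_apply, map_mul, map_prod, map_pow,
    Finset.prod_mul_distrib, map_intCast]
  ring

/-- The integral of the squared Vandermonde determinant against a product of identical rotation
invariant weights. -/
lemma integral_prod_norm_sub_sq_radial (n : ℕ) {g : ℝ → ℝ} (hg : Measurable g)
    (hg0 : ∀ r, 0 ≤ g r)
    (hint : ∀ k < n, Integrable fun z : ℂ => ‖z‖ ^ (2 * k) * g ‖z‖) :
    ∫⁻ x : Fin n → ℂ, ENNReal.ofReal
      ((∏ i : Fin n, ∏ j ∈ Finset.Ioi i, ‖x i - x j‖ ^ 2) * ∏ i, g ‖x i‖) =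
    ENNReal.ofReal (n.factorial * ∏ k ∈ Finset.range n, ∫ z : ℂ, ‖z‖ ^ (2 * k) * g ‖z‖) := by
  set F : (Fin n → ℂ) → ℝ := fun x =>
    (∏ i : Fin n, ∏ j ∈ Finset.Ioi i, ‖x i - x j‖ ^ 2) * ∏ i, g ‖x i‖ with hF
  set f : Equiv.Perm (Fin n) → Equiv.Perm (Fin n) → Fin n → ℂ → ℂ := fun σ τ i z =>
    z ^ (σ i : ℕ) * (starRingEnd ℂ z) ^ (τ i : ℕ) * (g ‖z‖ : ℂ) with hf
  have hFf : ∀ x, (F x : ℂ) = ∑ σ : Equiv.Perm (Fin n), ∑ τ : Equiv.Perm (Fin n),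
      ((Equiv.Perm.sign σ : ℤ) : ℂ) * ((Equiv.Perm.sign τ : ℤ) : ℂ) * ∏ i, f σ τ i (x i) := by
    intro x
    simp only [hF, hf]
    rw [Complex.ofReal_mul, prod_norm_sub_sq_eq_sum, Finset.sum_mul]
    refine Finset.sum_congr rfl fun σ _ => ?_
    rw [Finset.sum_mul]
    refine Finset.sum_congr rfl fun τ _ => ?_
    push_cast
    simp only [Finset.prod_mul_distrib]
    ring
  have hfi : ∀ σ τ : Equiv.Perm (Fin n), Integrable fun x : Fin n → ℂ =>
      ((Equiv.Perm.sign σ : ℤ) : ℂ) * ((Equiv.Perm.sign τ : ℤ) : ℂ) * ∏ i, f σ τ i (x i) :=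
    fun σ τ => (Integrable.fintype_prod fun i => integrable_pow_mul_conj_pow_radial hg hg0
      (hint _ (σ i).2) (hint _ (τ i).2)).const_mul _
  have hFc : Integrable fun x => (F x : ℂ) := by
    simp_rw [hFf]
    exact integrable_finsetSum _ fun σ _ => integrable_finsetSum _ fun τ _ => hfi σ τ
  have hFi : Integrable F := by simpa using hFc.re
  have hF0 : ∀ x, 0 ≤ F x := fun x => mul_nonneg
    (Finset.prod_nonneg fun i _ => Finset.prod_nonneg fun j _ => sq_nonneg _)
    (Finset.prod_nonneg fun i _ => hg0 _)
  rw [← ofReal_integral_eq_lintegral_ofReal hFi (ae_of_all _ hF0)]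
  congr 1
  have hdiag : ∀ k : ℕ, ∫ z : ℂ, z ^ k * (starRingEnd ℂ z) ^ k * (g ‖z‖ : ℂ) =
      ((∫ z : ℂ, ‖z‖ ^ (2 * k) * g ‖z‖ : ℝ) : ℂ) := by
    intro k
    rw [← integral_complex_ofReal]
    refine integral_congr_ae (ae_of_all _ fun z => ?_)
    simp only
    rw [← mul_pow, Complex.mul_conj, Complex.normSq_eq_norm_sq]
    push_cast
    ring
  rw [← Complex.ofReal_inj, ← integral_complex_ofReal]
  simp_rw [hFf]
  rw [integral_finsetSum _ fun σ _ => integrable_finsetSum _ fun τ _ => hfi σ τ]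
  -- For fixed `σ` only `τ = σ` survives, since a disagreement at one index gives a vanishing
  -- factor. The result is independent of `σ`, hence the `n!`.
  have hσ : ∀ σ : Equiv.Perm (Fin n), ∫ x : Fin n → ℂ, ∑ τ : Equiv.Perm (Fin n),
      ((Equiv.Perm.sign σ : ℤ) : ℂ) * ((Equiv.Perm.sign τ : ℤ) : ℂ) * ∏ i, f σ τ i (x i) =
      ((∏ k ∈ Finset.range n, ∫ z : ℂ, ‖z‖ ^ (2 * k) * g ‖z‖ : ℝ) : ℂ) := by
    intro σ
    rw [integral_finsetSum _ fun τ _ => hfi σ τ, Finset.sum_eq_single σ]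
    · rw [integral_const_mul, integral_fintype_prod_volume_eq_prod]
      simp only [hf, hdiag]
      rw [← Int.cast_mul, Int.units_coe_mul_self, Int.cast_one, one_mul,
        ← Fin.prod_univ_eq_prod_range
          (fun k => ∫ z : ℂ, ‖z‖ ^ (2 * k) * g ‖z‖), Complex.ofReal_prod]
      exact Equiv.prod_comp σ
        (fun k : Fin n => ((∫ z : ℂ, ‖z‖ ^ (2 * (k : ℕ)) * g ‖z‖ : ℝ) : ℂ))
    · intro τ _ hτ
      rw [integral_const_mul, integral_fintype_prod_volume_eq_prod]
      obtain ⟨i, hi⟩ : ∃ i, σ i ≠ τ i := by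
        by_contra! h
        exact hτ (Equiv.ext h).symm
      rw [Finset.prod_eq_zero (Finset.mem_univ i), mul_zero]
      exact integral_pow_mul_conj_pow_radial g fun h => hi (Fin.ext h)
    · simp
  simp_rw [hσ]
  rw [Finset.sum_const, Finset.card_univ, Fintype.card_perm, Fintype.card_fin, nsmul_eq_mul]
  push_cast
  rfl

/-! ### Incomplete Gamma integrals and radial moments. -/

/-- The probability that a Poisson variable of parameter `s` is at most `k`, which is also the
probability that a Gamma variable of shape `k + 1` exceeds `s`. -/
def poissonCDF (k : ℕ) (s : ℝ) : ℝ :=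
  Real.exp (-s) * ∑ j ∈ Finset.range (k + 1), s ^ j / j.factorial

lemma poissonCDF_succ (k : ℕ) (s : ℝ) :
    poissonCDF (k + 1) s = poissonCDF k s + Real.exp (-s) * (s ^ (k + 1) / (k + 1).factorial) := by
  unfold poissonCDF
  rw [Finset.sum_range_succ, mul_add]

lemma poissonCDF_zero_right (k : ℕ) : poissonCDF k 0 = 1 := by
  unfold poissonCDF
  rw [Finset.sum_range_succ']
  simp

lemma poissonCDF_nonneg (k : ℕ) {s : ℝ} (hs : 0 ≤ s) : 0 ≤ poissonCDF k s :=
  mul_nonneg (Real.exp_pos _).le (Finset.sum_nonneg fun _ _ => by positivity)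

lemma poissonCDF_le_one (k : ℕ) {s : ℝ} (hs : 0 ≤ s) : poissonCDF k s ≤ 1 := by
  unfold poissonCDF
  rw [Real.exp_neg, inv_mul_le_iff₀ (Real.exp_pos _), mul_one]
  exact Real.sum_le_exp_of_nonneg hs _

lemma poissonCDF_mono {s : ℝ} (hs : 0 ≤ s) : Monotone fun k => poissonCDF k s :=
  monotone_nat_of_le_succ fun k => by
    rw [poissonCDF_succ]
    exact le_add_of_nonneg_right (by positivity)

/-- Differentiating term by term telescopes and leaves only the top Poisson mass, so this is minus a
Gamma density. It supplies the antiderivative for the truncated moments. -/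
lemma hasDerivAt_poissonCDF (k : ℕ) (s : ℝ) :
    HasDerivAt (poissonCDF k) (-(Real.exp (-s) * (s ^ k / k.factorial))) s := by
  have he : HasDerivAt (fun s : ℝ => Real.exp (-s)) (-Real.exp (-s)) s := by
    simpa using (hasDerivAt_neg s).exp
  induction k with
  | zero =>
    have : poissonCDF 0 = fun s => Real.exp (-s) := by
      funext s; simp [poissonCDF]
    rw [this]
    simpa using he
  | succ k ih =>
    have : poissonCDF (k + 1) = fun s =>
        poissonCDF k s + Real.exp (-s) * (s ^ (k + 1) / (k + 1).factorial) :=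
      funext fun s => poissonCDF_succ k s
    rw [this]
    refine (ih.add (he.mul ((hasDerivAt_pow (k + 1) s).div_const _))).congr_deriv ?_
    rw [Nat.factorial_succ]
    have := k.factorial_pos
    push_cast
    field_simp
    simp

lemma integral_pow_mul_exp_neg_mul_sq (k : ℕ) {κ : ℝ} (hκ : 0 < κ) (r : ℝ) :
    ∫ y in (0 : ℝ)..r, y ^ (2 * k + 1) * Real.exp (-(κ * y ^ 2)) =
      k.factorial / (2 * κ ^ (k + 1)) * (1 - poissonCDF k (κ * r ^ 2)) := by
  have hd : ∀ y ∈ Set.uIcc 0 r, HasDerivAt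
      (fun y => -(k.factorial / (2 * κ ^ (k + 1)) * poissonCDF k (κ * y ^ 2)))
      (y ^ (2 * k + 1) * Real.exp (-(κ * y ^ 2))) y := by
    intro y _
    have h2 := (hasDerivAt_poissonCDF k (κ * y ^ 2)).comp y ((hasDerivAt_pow 2 y).const_mul κ)
    refine (h2.const_mul (k.factorial / (2 * κ ^ (k + 1)) : ℝ)).neg.congr_deriv ?_
    have := k.factorial_pos
    field_simp
    ring
  rw [intervalIntegral.integral_eq_sub_of_hasDerivAt hd
    (Continuous.intervalIntegrable (by fun_prop) _ _)]
  simp only [ne_eq, OfNat.ofNat_ne_zero, not_false_eq_true, zero_pow, mul_zero,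
    poissonCDF_zero_right]
  ring

/-- The radial profile of the one-particle weight `exp (-2 n V)`. -/
def jelliumWeight (R α : ℝ) (r : ℝ) : ℝ :=
  if r ≤ R then Real.exp (2 * α * (-Real.log R + (1 - r ^ 2 / R ^ 2) / 2))
  else Real.exp (2 * α * (-Real.log r))

lemma jelliumWeight_pos (R α r : ℝ) : 0 < jelliumWeight R α r := by
  unfold jelliumWeight
  split_ifs <;> exact Real.exp_pos _

lemma measurable_jelliumWeight (R α : ℝ) : Measurable (jelliumWeight R α) := by
  unfold jelliumWeight
  exact Measurable.ite measurableSet_Iic (by fun_prop) (by fun_prop)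

lemma jelliumWeight_norm {R : ℝ} (hR : 0 < R) (α : ℝ) {n : ℕ} (hn : n ≠ 0) (x : ℂ) :
    jelliumWeight R α ‖x‖ = Real.exp (-(2 * (n * jelliumPotential R α n x))) := by
  have : -(2 * (n * jelliumPotential R α n x)) =
      2 * α * coulombPotential (uniformDisc R) x := by
    unfold jelliumPotential
    field_simp
  rw [this]
  unfold jelliumWeight
  split_ifs with h
  · rw [coulombPotential_uniformDisc_of_ge hR h]
  · rw [coulombPotential_uniformDisc_of_le hR (le_of_not_ge h)]

lemma integrableOn_Ioc_pow_mul_jelliumWeight (R α : ℝ) (k : ℕ) :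
    IntegrableOn (fun y => y ^ (2 * k + 1) * jelliumWeight R α y) (Set.Ioc 0 R) := by
  have hc : Continuous fun y : ℝ => y ^ (2 * k + 1) *
    Real.exp (2 * α * (-Real.log R + (1 - y ^ 2 / R ^ 2) / 2)) := by fun_prop
  refine (hc.integrableOn_Ioc (a := 0) (b := R)).congr_fun (fun y hy => ?_) measurableSet_Ioc
  simp only [jelliumWeight, if_pos hy.2]

lemma integral_Ioc_pow_mul_jelliumWeight {R α : ℝ} (hR : 0 < R) (hα : 0 < α) (k : ℕ) {r : ℝ}
    (hr0 : 0 ≤ r) (hr : r ≤ R) :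
    ∫ y in Set.Ioc 0 r, y ^ (2 * k + 1) * jelliumWeight R α y =
      Real.exp (α - 2 * α * Real.log R) * (k.factorial / (2 * (α / R ^ 2) ^ (k + 1))) *
        (1 - poissonCDF k (α / R ^ 2 * r ^ 2)) := by
  rw [mul_assoc, ← integral_pow_mul_exp_neg_mul_sq k (by positivity) r,
    intervalIntegral.integral_of_le hr0, ← integral_const_mul]
  refine setIntegral_congr_fun measurableSet_Ioc fun y hy => ?_
  simp only [jelliumWeight, if_pos (hy.2.trans hr)]
  rw [mul_left_comm, ← Real.exp_add]
  congr 2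
  field_simp
  ring

lemma pow_mul_jelliumWeight_eq_rpow {R α : ℝ} (hR : 0 < R) (k : ℕ) {y : ℝ} (hy : R < y) :
    y ^ (2 * k + 1) * jelliumWeight R α y = y ^ ((2 * k + 1 : ℝ) - 2 * α) := by
  have hy0 : 0 < y := hR.trans hy
  rw [jelliumWeight, if_neg hy.not_ge, Real.rpow_sub hy0, Real.rpow_def_of_pos hy0 (2 * α),
    div_eq_mul_inv, ← Real.exp_neg]
  congr 1
  · exact_mod_cast (Real.rpow_natCast y (2 * k + 1)).symm
  · congr 1; ring

/-- Confinement enters here: the tail is a power with exponent `2k + 1 - 2α`, below `-1` exactly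
when `k + 1 < α`. For all `k < n` this follows from `n < α`. -/
lemma integrableOn_Ioi_pow_mul_jelliumWeight {R α : ℝ} (hR : 0 < R) {k : ℕ}
    (hk : (k : ℝ) + 1 < α) :
    IntegrableOn (fun y => y ^ (2 * k + 1) * jelliumWeight R α y) (Set.Ioi R) :=
  (integrableOn_Ioi_rpow_of_lt (by linarith) hR).congr_fun
    (fun _ hy => (pow_mul_jelliumWeight_eq_rpow hR k hy).symm) measurableSet_Ioi

lemma integral_Ioi_pow_mul_jelliumWeight {R α : ℝ} (hR : 0 < R) {k : ℕ}
    (hk : (k : ℝ) + 1 < α) :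
    ∫ y in Set.Ioi R, y ^ (2 * k + 1) * jelliumWeight R α y =
      Real.exp (-(2 * α * Real.log R)) * (R ^ (2 * k + 2) / (2 * (α - k - 1))) := by
  rw [setIntegral_congr_fun measurableSet_Ioi
    fun y hy => pow_mul_jelliumWeight_eq_rpow hR k hy, integral_Ioi_rpow_of_lt (by linarith) hR]
  have h1 : (2 * k + 1 : ℝ) - 2 * α + 1 = (2 * k + 2 : ℕ) + -(2 * α) := by push_cast; ring
  rw [h1, Real.rpow_add hR, Real.rpow_natCast, Real.rpow_def_of_pos hR]
  have h2 : α - k - 1 ≠ 0 := by linarith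
  have h3 : ((2 * k + 2 : ℕ) + -(2 * α) : ℝ) = -(2 * (α - k - 1)) := by push_cast; ring
  rw [h3, neg_div_neg_eq, show Real.log R * -(2 * α) = -(2 * α * Real.log R) by ring]
  ring

/-- The mass, relative to `k!`, that the weight puts outside of the disc in degree `k`. -/
def outerMass (k : ℕ) (α : ℝ) : ℝ :=
  Real.exp (-α) * (α ^ (k + 1) / (k.factorial * (α - k - 1)))

/-- The normalising constant of the radial density of degree `k`. -/
def momentConst (R α : ℝ) (k : ℕ) : ℝ :=
  2 * Real.pi * (Real.exp (α - 2 * α * Real.log R) * (k.factorial / (2 * (α / R ^ 2) ^ (k + 1))))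

lemma momentConst_pos {R α : ℝ} (hR : 0 < R) (hα : 0 < α) (k : ℕ) : 0 < momentConst R α k := by
  unfold momentConst
  have := Real.pi_pos
  have := k.factorial_pos
  positivity

lemma integral_radial (f : ℝ → ℝ) (k : ℕ) :
    ∫ z : ℂ, ‖z‖ ^ (2 * k) * f ‖z‖ =
      2 * Real.pi * ∫ y in Set.Ioi (0 : ℝ), y ^ (2 * k + 1) * f y := by
  rw [integral_fun_norm_addHaar volume (fun y : ℝ => y ^ (2 * k) * f y)]
  have h : (volume : Measure ℂ).real (Metric.ball 0 1) = Real.pi := by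
    rw [measureReal_def, Complex.volume_ball]
    simp
  rw [h, Complex.finrank_real_complex, nsmul_eq_mul, smul_eq_mul, ← mul_assoc]
  push_cast
  congr 1
  refine integral_congr_ae (ae_of_all _ fun y => ?_)
  simp only [smul_eq_mul]
  ring

lemma integrable_radial_iff (f : ℝ → ℝ) (k : ℕ) :
    Integrable (fun z : ℂ => ‖z‖ ^ (2 * k) * f ‖z‖) ↔
      IntegrableOn (fun y => y ^ (2 * k + 1) * f y) (Set.Ioi (0 : ℝ)) := by
  rw [integrable_fun_norm_addHaar volume (f := fun y : ℝ => y ^ (2 * k) * f y),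
    Complex.finrank_real_complex]
  simp only [smul_eq_mul]
  refine integrableOn_congr_fun (fun y _ => ?_) measurableSet_Ioi
  ring

lemma integrable_moment {R α : ℝ} (hR : 0 < R) {k : ℕ} (hk : (k : ℝ) + 1 < α) :
    Integrable fun z : ℂ => ‖z‖ ^ (2 * k) * jelliumWeight R α ‖z‖ := by
  rw [integrable_radial_iff, ← Set.Ioc_union_Ioi_eq_Ioi hR.le]
  exact (integrableOn_Ioc_pow_mul_jelliumWeight R α k).union
    (integrableOn_Ioi_pow_mul_jelliumWeight hR hk)

lemma integral_moment {R α : ℝ} (hR : 0 < R) {k : ℕ} (hk : (k : ℝ) + 1 < α) :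
    ∫ z : ℂ, ‖z‖ ^ (2 * k) * jelliumWeight R α ‖z‖ =
      momentConst R α k * (1 - poissonCDF k α + outerMass k α) := by
  have hα : 0 < α := lt_trans (by positivity) hk
  rw [integral_radial, ← Set.Ioc_union_Ioi_eq_Ioi hR.le,
    setIntegral_union (Set.Ioc_disjoint_Ioi le_rfl) measurableSet_Ioi
      (integrableOn_Ioc_pow_mul_jelliumWeight R α k)
      (integrableOn_Ioi_pow_mul_jelliumWeight hR hk),
    integral_Ioc_pow_mul_jelliumWeight hR hα k hR.le le_rfl,
    integral_Ioi_pow_mul_jelliumWeight hR hk, div_mul_cancel₀ _ (by positivity), mul_add, mul_add]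
  congr 1
  · unfold momentConst; ring
  · unfold momentConst outerMass
    have h2 : α - k - 1 ≠ 0 := by linarith
    have := k.factorial_pos
    rw [Real.exp_sub, Real.exp_neg, Real.exp_neg, div_pow]
    field_simp
    ring

/-- With `r ≤ R` only the Gaussian part of the weight is seen, so the logarithmic tail affects only
the normalisation. -/
lemma integral_truncated_moment {R α : ℝ} (hR : 0 < R) (hα : 0 < α) (k : ℕ) {r : ℝ}
    (hr0 : 0 ≤ r) (hr : r ≤ R) :
    ∫ z : ℂ, ‖z‖ ^ (2 * k) * (Set.Iic r).indicator (jelliumWeight R α) ‖z‖ =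
      momentConst R α k * (1 - poissonCDF k (α / R ^ 2 * r ^ 2)) := by
  rw [integral_radial]
  have : (fun y : ℝ => y ^ (2 * k + 1) * (Set.Iic r).indicator (jelliumWeight R α) y) =
      (Set.Iic r).indicator fun y => y ^ (2 * k + 1) * jelliumWeight R α y := by
    funext y
    by_cases h : y ∈ Set.Iic r <;> simp [h]
  rw [this, setIntegral_indicator measurableSet_Iic, Set.Ioi_inter_Iic,
    integral_Ioc_pow_mul_jelliumWeight hR hα k hr0 hr]
  unfold momentConst
  ring

/-! ### Partition function and law of the farthest particle. -/

lemma volume_coordinates_eq {n : ℕ} {i j : Fin n} (hij : i ≠ j) :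
    volume {x : Fin n → ℂ | x i = x j} = 0 := by
  let L : (Fin n → ℂ) →ₗ[ℝ] ℂ :=
    LinearMap.proj (R := ℝ) (φ := fun _ : Fin n => ℂ) i - LinearMap.proj (R := ℝ) (φ := fun _ : Fin n => ℂ) j
  have h : {x : Fin n → ℂ | x i = x j} = (LinearMap.ker L : Set (Fin n → ℂ)) := by
    ext x
    simp [L, sub_eq_zero]
  rw [h]
  refine Measure.addHaar_submodule volume _ fun ht => ?_
  have : (Pi.single i 1 : Fin n → ℂ) ∈ LinearMap.ker L := ht ▸ Submodule.mem_top
  simp [L, hij.symm] at this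

/-- The equality is only almost everywhere: where two points coincide, `Real.log 0 = 0` contributes
a factor `1` instead of `0`. -/
lemma gibbsWeight_ae_eq {R : ℝ} (hR : 0 < R) (α : ℝ) {n : ℕ} (hn : n ≠ 0) :
    gibbsWeight 2 n (jelliumPotential R α n) =ᵐ[volume] fun x : Fin n → ℂ => ENNReal.ofReal
      ((∏ i : Fin n, ∏ j ∈ Finset.Ioi i, ‖x i - x j‖ ^ 2) * ∏ i, jelliumWeight R α ‖x i‖) := by
  have hne : ∀ᵐ x : Fin n → ℂ, ∀ i j : Fin n, i ≠ j → x i ≠ x j := by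
    rw [ae_all_iff]; intro i
    rw [ae_all_iff]; intro j
    by_cases h : i = j
    · simp [h]
    · refine measure_mono_null (fun x hx => ?_) (volume_coordinates_eq h)
      simpa [h] using hx
  filter_upwards [hne] with x hx
  unfold gibbsWeight
  congr 1
  have : -(2 * energy n (jelliumPotential R α n) x) =
      (∑ i : Fin n, ∑ j ∈ Finset.Ioi i, 2 * Real.log ‖x i - x j‖) +
        ∑ i : Fin n, -(2 * (n * jelliumPotential R α n (x i))) := by
    unfold energy coulombKernel
    simp only [Finset.sum_neg_distrib, ← Finset.mul_sum]
    ring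
  rw [this, Real.exp_add, Real.exp_sum, Real.exp_sum]
  simp_rw [Real.exp_sum, jelliumWeight_norm hR α hn]
  congr 1
  refine Finset.prod_congr rfl fun i _ => Finset.prod_congr rfl fun j hj => ?_
  have hpos : 0 < ‖x i - x j‖ :=
    norm_pos_iff.2 (sub_ne_zero.2 (hx i j (Finset.mem_Ioi.1 hj).ne))
  rw [two_mul, Real.exp_add, Real.exp_log hpos, sq]

lemma maxModulus_le_iff {n : ℕ} (hn : n ≠ 0) (x : Fin n → ℂ) (r : ℝ) :
    maxModulus x ≤ r ↔ ∀ i, ‖x i‖ ≤ r := by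
  have : Nonempty (Fin n) := Fin.pos_iff_nonempty.1 (Nat.pos_of_ne_zero hn)
  exact ciSup_le_iff (Set.finite_range _).bddAbove

lemma measurable_maxModulus (n : ℕ) : Measurable (maxModulus (n := n)) := by
  unfold maxModulus
  exact Measurable.iSup fun i => by fun_prop

lemma partitionFunction_jellium {R α : ℝ} (hR : 0 < R) {n : ℕ} (hn : n ≠ 0) (hα : (n : ℝ) < α) :
    partitionFunction 2 n (jelliumPotential R α n) = ENNReal.ofReal (n.factorial *
      ∏ k ∈ Finset.range n, momentConst R α k * (1 - poissonCDF k α + outerMass k α)) := by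
  have hk : ∀ k < n, (k : ℝ) + 1 < α := fun k hk =>
    lt_of_le_of_lt (by exact_mod_cast hk) hα
  unfold partitionFunction
  rw [lintegral_congr_ae (gibbsWeight_ae_eq hR α hn),
    integral_prod_norm_sub_sq_radial n (measurable_jelliumWeight R α)
      (fun r => (jelliumWeight_pos R α r).le) fun k h => integrable_moment hR (hk k h)]
  congr 2
  exact Finset.prod_congr rfl fun k h => integral_moment hR (hk k (Finset.mem_range.1 h))

lemma withDensity_maxModulus_le {R α : ℝ} (hR : 0 < R) {n : ℕ} (hn : n ≠ 0) (hα : (n : ℝ) < α)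
    {r : ℝ} (hr0 : 0 ≤ r) (hr : r ≤ R) :
    volume.withDensity (gibbsWeight 2 n (jelliumPotential R α n)) {x | maxModulus x ≤ r} =
      ENNReal.ofReal (n.factorial *
        ∏ k ∈ Finset.range n, momentConst R α k * (1 - poissonCDF k (α / R ^ 2 * r ^ 2))) := by
  have hk : ∀ k < n, (k : ℝ) + 1 < α := fun k hk =>
    lt_of_le_of_lt (by exact_mod_cast hk) hα
  have hα0 : 0 < α := lt_of_le_of_lt (Nat.cast_nonneg n) hα
  have hms : MeasurableSet {x : Fin n → ℂ | maxModulus x ≤ r} :=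
    measurable_maxModulus n measurableSet_Iic
  rw [withDensity_apply _ hms, ← lintegral_indicator hms]
  have hae : ∀ᵐ x : Fin n → ℂ, {x : Fin n → ℂ | maxModulus x ≤ r}.indicator
      (gibbsWeight 2 n (jelliumPotential R α n)) x = ENNReal.ofReal
      ((∏ i : Fin n, ∏ j ∈ Finset.Ioi i, ‖x i - x j‖ ^ 2) *
        ∏ i, (Set.Iic r).indicator (jelliumWeight R α) ‖x i‖) := by
    filter_upwards [gibbsWeight_ae_eq hR α hn] with x hx
    by_cases h : maxModulus x ≤ r
    · rw [Set.indicator_of_mem (by exact h), hx]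
      rw [maxModulus_le_iff hn] at h
      congr 2
      refine Finset.prod_congr rfl fun i _ => ?_
      rw [Set.indicator_of_mem (by exact h i)]
    · rw [Set.indicator_of_notMem (by exact h)]
      rw [maxModulus_le_iff hn] at h
      push Not at h
      obtain ⟨i, hi⟩ := h
      have h0 : (Set.Iic r).indicator (jelliumWeight R α) ‖x i‖ = 0 :=
        Set.indicator_of_notMem (by simpa using hi) _
      rw [Finset.prod_eq_zero (f := fun i => (Set.Iic r).indicator (jelliumWeight R α) ‖x i‖)
        (Finset.mem_univ i) h0, mul_zero, ENNReal.ofReal_zero]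
  rw [lintegral_congr_ae hae, integral_prod_norm_sub_sq_radial n
    ((measurable_jelliumWeight R α).indicator measurableSet_Iic)
    (fun y => Set.indicator_nonneg (fun y _ => (jelliumWeight_pos R α y).le) y) fun k h => ?_]
  · congr 2
    exact Finset.prod_congr rfl fun k h => integral_truncated_moment hR hα0 k hr0 hr
  · refine (integrable_moment hR (hk k h)).mono' ?_ (ae_of_all _ fun z => ?_)
    · refine Measurable.aestronglyMeasurable ?_
      exact (by fun_prop : Measurable fun z : ℂ => ‖z‖ ^ (2 * k)).mul
        (((measurable_jelliumWeight R α).indicator measurableSet_Iic).comp measurable_norm)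
    · have h1 := (jelliumWeight_pos R α ‖z‖).le
      rw [norm_mul, norm_pow, norm_norm]
      refine mul_le_mul_of_nonneg_left ?_ (by positivity)
      refine (norm_indicator_le_norm_self _ _).trans ?_
      rw [Real.norm_of_nonneg h1]

lemma outerMass_pos {k : ℕ} {α : ℝ} (hk : (k : ℝ) + 1 < α) : 0 < outerMass k α := by
  have hα : 0 < α := lt_trans (by positivity) hk
  have : 0 < α - k - 1 := by linarith
  have := k.factorial_pos
  unfold outerMass
  positivity

lemma one_sub_poissonCDF_add_outerMass_pos {k : ℕ} {α : ℝ} (hk : (k : ℝ) + 1 < α) :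
    0 < 1 - poissonCDF k α + outerMass k α := by
  have hα : 0 < α := lt_trans (by positivity) hk
  linarith [outerMass_pos hk, poissonCDF_le_one k hα.le]

lemma partitionFunction_jellium_ne_zero {R α : ℝ} (hR : 0 < R) {n : ℕ} (hn : n ≠ 0)
    (hα : (n : ℝ) < α) : partitionFunction 2 n (jelliumPotential R α n) ≠ 0 := by
  have hα0 : 0 < α := lt_of_le_of_lt (Nat.cast_nonneg n) hα
  rw [partitionFunction_jellium hR hn hα]
  refine (ENNReal.ofReal_pos.2 (mul_pos (by exact_mod_cast n.factorial_pos)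
    (Finset.prod_pos fun k h => mul_pos (momentConst_pos hR hα0 k)
      (one_sub_poissonCDF_add_outerMass_pos ?_)))).ne'
  exact lt_of_le_of_lt (by exact_mod_cast Finset.mem_range.1 h) hα

lemma partitionFunction_jellium_lt_top {R α : ℝ} (hR : 0 < R) {n : ℕ} (hn : n ≠ 0)
    (hα : (n : ℝ) < α) : partitionFunction 2 n (jelliumPotential R α n) < ⊤ := by
  rw [partitionFunction_jellium hR hn hα]
  exact ENNReal.ofReal_lt_top

lemma isProbabilityMeasure_coulombGas {R α : ℝ} (hR : 0 < R) {n : ℕ} (hn : n ≠ 0)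
    (hα : (n : ℝ) < α) : IsProbabilityMeasure (coulombGas 2 n (jelliumPotential R α n)) := by
  refine ⟨?_⟩
  rw [coulombGas, Measure.smul_apply, withDensity_apply _ MeasurableSet.univ,
    Measure.restrict_univ, smul_eq_mul]
  exact ENNReal.inv_mul_cancel (partitionFunction_jellium_ne_zero hR hn hα)
    (partitionFunction_jellium_lt_top hR hn hα).ne

/-- The distribution function of the farthest particle is a product of `n` distribution functions
of moduli, as in Kostlan's theorem. -/
lemma coulombGas_maxModulus_le {R α : ℝ} (hR : 0 < R) {n : ℕ} (hn : n ≠ 0) (hα : (n : ℝ) < α)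
    {r : ℝ} (hr0 : 0 ≤ r) (hr : r ≤ R) :
    coulombGas 2 n (jelliumPotential R α n) {x | maxModulus x ≤ r} =
      ENNReal.ofReal ((∏ k ∈ Finset.range n, (1 - poissonCDF k (α / R ^ 2 * r ^ 2))) /
        ∏ k ∈ Finset.range n, (1 - poissonCDF k α + outerMass k α)) := by
  have hα0 : 0 < α := lt_of_le_of_lt (Nat.cast_nonneg n) hα
  have hpos : ∀ k ∈ Finset.range n, 0 < 1 - poissonCDF k α + outerMass k α := fun k h =>
    one_sub_poissonCDF_add_outerMass_pos
      (lt_of_le_of_lt (by exact_mod_cast Finset.mem_range.1 h) hα)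
  rw [coulombGas, Measure.smul_apply, smul_eq_mul, withDensity_maxModulus_le hR hn hα hr0 hr,
    partitionFunction_jellium hR hn hα, mul_comm, ← div_eq_mul_inv, Finset.prod_mul_distrib,
    Finset.prod_mul_distrib, ← ENNReal.ofReal_div_of_pos]
  · congr 1
    -- The common factors `n!` and `∏ momentConst` cancel.
    rw [← mul_assoc, ← mul_assoc, mul_div_mul_left]
    refine mul_ne_zero (by exact_mod_cast n.factorial_ne_zero)
      (Finset.prod_pos fun k _ => momentConst_pos hR hα0 k).ne'
  · exact mul_pos (by exact_mod_cast n.factorial_pos)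
      (mul_pos (Finset.prod_pos fun k _ => momentConst_pos hR hα0 k) (Finset.prod_pos hpos))

/-! ### Geometric approximation of sums of Poisson tails. -/

/-- The quotient of the descending factorial by `n ^ m` is the product of the `1 - i / n`, `i < m`,
so it loses at most `m² / n`. Beyond `n` the left side is nonpositive. -/
lemma pow_mul_one_sub_le_descFactorial {n : ℕ} (hn : n ≠ 0) (m : ℕ) :
    (n : ℝ) ^ m * (1 - (m : ℝ) ^ 2 / n) ≤ n.descFactorial m := by
  have hn0 : (0 : ℝ) < n := by exact_mod_cast Nat.pos_of_ne_zero hn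
  induction m with
  | zero => simp
  | succ m ih =>
    rcases lt_or_ge m n with h | h
    · have hm : (m : ℝ) ≤ n := by exact_mod_cast h.le
      rw [Nat.descFactorial_succ, Nat.cast_mul, Nat.cast_sub h.le]
      refine le_trans ?_ (mul_le_mul_of_nonneg_left ih (sub_nonneg.2 hm))
      have : ((n : ℝ) - m) * (n ^ m * (1 - (m : ℝ) ^ 2 / n)) =
          n ^ (m + 1) * (1 - (m : ℝ) / n - (m : ℝ) ^ 2 / n + m ^ 3 / n ^ 2) := by
        field_simp
        ring
      rw [this]
      refine mul_le_mul_of_nonneg_left ?_ (by positivity)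
      have h1 : ((m + 1 : ℕ) : ℝ) ^ 2 / n = (m : ℝ) / n + (m : ℝ) ^ 2 / n + (m + 1) / n := by
        push_cast
        field_simp
        ring
      have h2 : 0 ≤ ((m : ℝ) + 1) / n := by positivity
      have h3 : 0 ≤ (m : ℝ) ^ 3 / n ^ 2 := by positivity
      linarith
    · refine le_trans ?_ (Nat.cast_nonneg _)
      refine mul_nonpos_of_nonneg_of_nonpos (by positivity) (sub_nonpos.2 ?_)
      rw [one_le_div hn0]
      have h1 : (n : ℝ) ≤ m := by exact_mod_cast h
      push_cast
      nlinarith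

/-- The probability that a Poisson variable of parameter `s` equals `n`. -/
def poissonMass (n : ℕ) (s : ℝ) : ℝ := Real.exp (-s) * (s ^ n / n.factorial)

lemma poissonMass_nonneg (n : ℕ) {s : ℝ} (hs : 0 ≤ s) : 0 ≤ poissonMass n s := by
  unfold poissonMass; positivity

lemma poissonMass_sub {n m : ℕ} (h : m ≤ n) {s : ℝ} (hs : 0 < s) :
    poissonMass (n - m) s = poissonMass n s * (n.descFactorial m / s ^ m) := by
  unfold poissonMass
  have h1 : ((n - m).factorial : ℝ) * n.descFactorial m = n.factorial := by
    exact_mod_cast Nat.factorial_mul_descFactorial h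
  have h2 : s ^ n = s ^ (n - m) * s ^ m := by rw [← pow_add, Nat.sub_add_cancel h]
  have h3 : ((n - m).factorial : ℝ) ≠ 0 := by exact_mod_cast (n - m).factorial_ne_zero
  have h4 : (n.descFactorial m : ℝ) ≠ 0 := by
    exact_mod_cast (Nat.pos_of_ne_zero fun h' => (Nat.descFactorial_eq_zero_iff_lt.1 h').not_ge h).ne'
  rw [h2, ← h1]
  field_simp

lemma poissonCDF_eq_sum (n : ℕ) (s : ℝ) :
    poissonCDF n s = ∑ j ∈ Finset.range (n + 1), poissonMass j s := by
  unfold poissonCDF poissonMass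
  rw [Finset.mul_sum]

lemma poissonCDF_pred_eq {n : ℕ} {s : ℝ} (hs : 0 < s) (hn : n ≠ 0) :
    poissonCDF (n - 1) s =
      poissonMass n s * ∑ i ∈ Finset.range n, n.descFactorial (i + 1) / s ^ (i + 1) := by
  rw [poissonCDF_eq_sum, Nat.sub_add_cancel (Nat.pos_of_ne_zero hn), Finset.mul_sum,
    ← Finset.sum_range_reflect]
  refine Finset.sum_congr rfl fun i hi => ?_
  rw [← poissonMass_sub (Finset.mem_range.1 hi) hs]
  congr 1
  lia

/-- The mass at `j` is counted once for each `k` with `j ≤ k < n`, that is `n - j` times; then `j =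
n - (i + 1)`. -/
lemma sum_poissonCDF_eq {n : ℕ} {s : ℝ} (hs : 0 < s) :
    ∑ k ∈ Finset.range n, poissonCDF k s =
      poissonMass n s * ∑ i ∈ Finset.range n,
        ((i : ℝ) + 1) * (n.descFactorial (i + 1) / s ^ (i + 1)) := by
  have h : ∀ n : ℕ, ∑ k ∈ Finset.range n, poissonCDF k s =
      ∑ j ∈ Finset.range n, ((n : ℝ) - j) * poissonMass j s := by
    intro n
    induction n with
    | zero => simp
    | succ n ih =>
      rw [Finset.sum_range_succ, ih, poissonCDF_eq_sum, Finset.sum_range_succ _ n,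
        Finset.sum_range_succ _ n, ← add_assoc, ← Finset.sum_add_distrib]
      push_cast
      congr 1
      · exact Finset.sum_congr rfl fun j _ => by ring
      · ring
  rw [h, Finset.mul_sum, ← Finset.sum_range_reflect]
  refine Finset.sum_congr rfl fun i hi => ?_
  have hi' := Finset.mem_range.1 hi
  rw [mul_left_comm, ← poissonMass_sub hi' hs, Nat.sub_sub, add_comm 1 i]
  congr 1
  rw [Nat.cast_sub hi']
  push_cast
  ring

lemma descFactorial_div_pow_le {n : ℕ} {s : ℝ} (hs : 0 < s) (m : ℕ) :
    n.descFactorial m / s ^ m ≤ (n / s) ^ m := by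
  rw [div_pow]
  gcongr
  exact_mod_cast Nat.descFactorial_le_pow n m

lemma le_descFactorial_div_pow {n : ℕ} {s : ℝ} (hs : 0 < s) (hn : n ≠ 0) (m : ℕ) :
    (n / s) ^ m * (1 - (m : ℝ) ^ 2 / n) ≤ n.descFactorial m / s ^ m := by
  rw [div_pow, div_mul_eq_mul_div]
  gcongr
  exact pow_mul_one_sub_le_descFactorial hn m

lemma hasSum_succ_mul_geometric {q : ℝ} (h0 : 0 ≤ q) (h1 : q < 1) :
    HasSum (fun i : ℕ => ((i : ℝ) + 1) * q ^ (i + 1)) (q * (1 / (1 - q) ^ 2)) := by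
  have := (hasSum_choose_mul_geometric_of_norm_lt_one 1
    (by rwa [Real.norm_of_nonneg h0] : ‖q‖ < 1)).mul_left q
  refine this.congr_fun ?_
  intro i
  simp [pow_succ]
  ring

/-- Bounding `(i + 1)³` by `(i + 1)(i + 2)(i + 3)`, six times a binomial coefficient, brings in the
series of `1 / (1 - q)⁴`. -/
lemma sum_cube_mul_geometric_le {q : ℝ} (h0 : 0 ≤ q) (h1 : q < 1) (n : ℕ) :
    ∑ i ∈ Finset.range n, ((i : ℝ) + 1) ^ 3 * q ^ (i + 1) ≤ q * (6 / (1 - q) ^ 4) := by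
  have h := ((hasSum_choose_mul_geometric_of_norm_lt_one 3
    (by rwa [Real.norm_of_nonneg h0] : ‖q‖ < 1)).mul_left (q * 6))
  have h2 : q * (6 / (1 - q) ^ 4) = q * 6 * (1 / (1 - q) ^ (3 + 1)) := by ring
  rw [h2]
  refine le_trans (Finset.sum_le_sum fun i _ => ?_)
    (sum_le_hasSum (Finset.range n) (fun i _ => by positivity) h)
  have hc : (((i + 3).choose 3 : ℕ) : ℝ) * 6 = (i + 3) * (i + 2) * (i + 1) := by
    have := Nat.descFactorial_eq_factorial_mul_choose (i + 3) 3
    simp only [Nat.descFactorial_succ, Nat.descFactorial_zero, Nat.factorial] at this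
    have e1 : i + 3 - 2 = i + 1 := by lia
    have e2 : i + 3 - 1 = i + 2 := by lia
    rw [e1, e2] at this
    have h' : (((i + 1) * ((i + 2) * ((i + 3 - 0) * 1)) : ℕ) : ℝ) =
        (((2 + 1) * ((1 + 1) * ((0 + 1) * 1)) * (i + 3).choose 3 : ℕ) : ℝ) :=
      congrArg _ this
    push_cast [Nat.sub_zero] at h'
    linarith
  have : q * 6 * (((i + 3).choose 3 : ℕ) * q ^ i) =
      (((i + 3).choose 3 : ℕ) * 6) * q ^ (i + 1) := by ring
  rw [this, hc]
  refine mul_le_mul_of_nonneg_right ?_ (by positivity)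
  have : (0 : ℝ) ≤ i := Nat.cast_nonneg i
  nlinarith [mul_nonneg this this]

lemma sum_poissonCDF_le {n : ℕ} {s : ℝ} (hs : (n : ℝ) < s) :
    ∑ k ∈ Finset.range n, poissonCDF k s ≤ poissonMass n s / (1 - n / s) ^ 2 := by
  have hs0 : 0 < s := lt_of_le_of_lt (Nat.cast_nonneg n) hs
  have hq0 : 0 ≤ n / s := by positivity
  have hq1 : n / s < 1 := (div_lt_one hs0).2 hs
  rw [sum_poissonCDF_eq hs0, div_eq_mul_inv]
  refine mul_le_mul_of_nonneg_left ?_ (poissonMass_nonneg n hs0.le)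
  have h1 : ∑ i ∈ Finset.range n, ((i : ℝ) + 1) * (n.descFactorial (i + 1) / s ^ (i + 1)) ≤
      ∑ i ∈ Finset.range n, ((i : ℝ) + 1) * (n / s) ^ (i + 1) :=
    Finset.sum_le_sum fun i _ =>
      mul_le_mul_of_nonneg_left (descFactorial_div_pow_le hs0 _) (by positivity)
  refine h1.trans ((sum_le_hasSum _ (fun i _ => by positivity)
    (hasSum_succ_mul_geometric hq0 hq1)).trans ?_)
  rw [one_div]
  exact mul_le_of_le_one_left (by positivity) hq1.le

/-- Replacing descending factorials by powers costs `m² / n` in the `m`-th term. After summation the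
relative error is at most `6 / (n (1 - q)²)`, which is why `n (1 - q)² → ∞` is required later. -/
lemma le_sum_poissonCDF {n : ℕ} {s : ℝ} (hs : (n : ℝ) < s) (hn : n ≠ 0) :
    poissonMass n s / (1 - n / s) ^ 2 * (n / s * (1 - 6 / (n * (1 - n / s) ^ 2))) ≤
      ∑ k ∈ Finset.range n, poissonCDF k s := by
  have hn0 : (0 : ℝ) < n := by exact_mod_cast Nat.pos_of_ne_zero hn
  have hs0 : 0 < s := lt_of_le_of_lt (Nat.cast_nonneg n) hs
  have hq0 : 0 ≤ n / s := by positivity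
  have hq1 : n / s < 1 := (div_lt_one hs0).2 hs
  set q : ℝ := n / s with hq
  rw [sum_poissonCDF_eq hs0, div_mul_eq_mul_div, mul_div_assoc]
  refine mul_le_mul_of_nonneg_left ?_ (poissonMass_nonneg n hs0.le)
  set w : ℕ → ℝ := fun i => ((i : ℝ) + 1) * (q ^ (i + 1) * (1 - ((i : ℝ) + 1) ^ 2 / n)) with hw
  have h1 : ∑ i ∈ Finset.range n, w i ≤
      ∑ i ∈ Finset.range n, ((i : ℝ) + 1) * (n.descFactorial (i + 1) / s ^ (i + 1)) := by
    refine Finset.sum_le_sum fun i _ => mul_le_mul_of_nonneg_left ?_ (by positivity)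
    have := le_descFactorial_div_pow hs0 hn (i + 1)
    push_cast at this
    exact this
  refine le_trans ?_ h1
  have h2 : Tendsto (fun N => ∑ i ∈ Finset.range N, ((i : ℝ) + 1) * q ^ (i + 1)) atTop
      (𝓝 (q * (1 / (1 - q) ^ 2))) := (hasSum_succ_mul_geometric hq0 hq1).tendsto_sum_nat
  have h3 : q * (1 / (1 - q) ^ 2) - q * (6 / (1 - q) ^ 4) / n ≤ ∑ i ∈ Finset.range n, w i := by
    -- Terms of index at least `n` are nonpositive, so the sum over `range n` dominates every longer
    -- one and the full series can be used.
    refine le_of_tendsto (h2.sub_const _) ?_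
    filter_upwards [eventually_ge_atTop n] with N hN
    have h4 : ∑ i ∈ Finset.range N, w i ≤ ∑ i ∈ Finset.range n, w i := by
      rw [← Finset.sum_range_add_sum_Ico _ hN]
      refine add_le_of_nonpos_right (Finset.sum_nonpos fun i hi => ?_)
      refine mul_nonpos_of_nonneg_of_nonpos (by positivity)
        (mul_nonpos_of_nonneg_of_nonpos (by positivity) (sub_nonpos.2 ?_))
      rw [one_le_div hn0]
      have : (n : ℝ) ≤ i := by exact_mod_cast (Finset.mem_Ico.1 hi).1
      nlinarith
    refine le_trans ?_ h4
    have h5 : ∑ i ∈ Finset.range N, w i =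
        ∑ i ∈ Finset.range N, ((i : ℝ) + 1) * q ^ (i + 1) -
          (∑ i ∈ Finset.range N, ((i : ℝ) + 1) ^ 3 * q ^ (i + 1)) / n := by
      rw [Finset.sum_div, ← Finset.sum_sub_distrib]
      refine Finset.sum_congr rfl fun i _ => ?_
      simp only [hw]
      ring
    rw [h5]
    gcongr
    exact sum_cube_mul_geometric_le hq0 hq1 N
  refine le_of_eq_of_le ?_ h3
  have : 1 - q ≠ 0 := by linarith
  field_simp

/-- This bounds the largest tail, one factor `1 - q` below the bound for the sum; hence no single
degree matters in the limit. -/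
lemma poissonCDF_pred_le {n : ℕ} {s : ℝ} (hs : (n : ℝ) < s) (hn : n ≠ 0) :
    poissonCDF (n - 1) s ≤ poissonMass n s / (1 - n / s) ^ 2 * (1 - n / s) := by
  have hs0 : 0 < s := lt_of_le_of_lt (Nat.cast_nonneg n) hs
  have hq0 : 0 ≤ n / s := by positivity
  have hq1 : n / s < 1 := (div_lt_one hs0).2 hs
  have hq2 : 1 - n / s ≠ 0 := by linarith
  have : poissonMass n s / (1 - n / s) ^ 2 * (1 - n / s) =
      poissonMass n s * (1 - n / s)⁻¹ := by
    field_simp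
  rw [poissonCDF_pred_eq hs0 hn, this]
  refine mul_le_mul_of_nonneg_left ?_ (poissonMass_nonneg n hs0.le)
  have h1 : ∑ i ∈ Finset.range n, n.descFactorial (i + 1) / s ^ (i + 1) ≤
      ∑ i ∈ Finset.range n, (n / s) ^ i := by
    refine Finset.sum_le_sum fun i _ => (descFactorial_div_pow_le hs0 _).trans ?_
    exact pow_le_pow_of_le_one hq0 hq1.le (Nat.le_succ i)
  exact h1.trans (sum_le_hasSum _ (fun i _ => by positivity)
    (hasSum_geometric_of_lt_one hq0 hq1))

lemma prod_one_sub_le_exp {ι : Type*} (t : Finset ι) (p : ι → ℝ) (h1 : ∀ i ∈ t, p i ≤ 1) :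
    ∏ i ∈ t, (1 - p i) ≤ Real.exp (-∑ i ∈ t, p i) := by
  rw [← Finset.sum_neg_distrib, Real.exp_sum]
  exact Finset.prod_le_prod (fun i hi => sub_nonneg.2 (h1 i hi))
    fun i _ => Real.one_sub_le_exp_neg _

/-- It follows from `log (1 - p) ≥ -p / (1 - p)`, with `M` bounding the denominators uniformly. -/
lemma exp_le_prod_one_sub {ι : Type*} (t : Finset ι) (p : ι → ℝ) {M : ℝ} (hM : M < 1)
    (h0 : ∀ i ∈ t, 0 ≤ p i) (h1 : ∀ i ∈ t, p i ≤ M) :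
    Real.exp (-((∑ i ∈ t, p i) / (1 - M))) ≤ ∏ i ∈ t, (1 - p i) := by
  rw [Finset.sum_div, ← Finset.sum_neg_distrib, Real.exp_sum]
  refine Finset.prod_le_prod (fun i _ => (Real.exp_pos _).le) fun i hi => ?_
  have h2 : 0 < 1 - p i := by linarith [h1 i hi]
  rw [← Real.le_log_iff_exp_le h2]
  refine le_trans ?_ (Real.one_sub_inv_le_log_of_pos h2)
  have h3 : p i / (1 - p i) ≤ p i / (1 - M) :=
    div_le_div_of_nonneg_left (h0 i hi) (by linarith) (by linarith [h1 i hi])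
  have h4 : 1 - (1 - p i)⁻¹ = -(p i / (1 - p i)) := by
    field_simp
    ring
  linarith

/-- The product of Gamma distribution functions converges as soon as the geometric approximation
of the sum of their tails does. -/
lemma tendsto_prod_one_sub_poissonCDF {s : ℕ → ℝ} {a : ℝ} (hs : ∀ᶠ n : ℕ in atTop, (n : ℝ) < s n)
    (hA : Tendsto (fun n : ℕ => poissonMass n (s n) / (1 - n / s n) ^ 2) atTop (𝓝 a))
    (hq : Tendsto (fun n : ℕ => n / s n) atTop (𝓝 1))
    (hx : Tendsto (fun n : ℕ => n * (1 - n / s n) ^ 2) atTop atTop) :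
    Tendsto (fun n : ℕ => ∏ k ∈ Finset.range n, (1 - poissonCDF k (s n))) atTop
      (𝓝 (Real.exp (-a))) := by
  have hS : Tendsto (fun n : ℕ => ∑ k ∈ Finset.range n, poissonCDF k (s n)) atTop (𝓝 a) := by
    have hlow : Tendsto (fun n : ℕ => poissonMass n (s n) / (1 - n / s n) ^ 2 *
        (n / s n * (1 - 6 / (n * (1 - n / s n) ^ 2)))) atTop (𝓝 a) := by
      have := hA.mul (hq.mul ((hx.const_div_atTop 6).const_sub 1))
      simpa using this
    refine tendsto_of_tendsto_of_tendsto_of_le_of_le' hlow hA ?_ ?_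
    · filter_upwards [hs, eventually_ne_atTop 0] with n h1 h2 using le_sum_poissonCDF h1 h2
    · filter_upwards [hs] with n h1 using sum_poissonCDF_le h1
  have hQ : Tendsto (fun n : ℕ => poissonMass n (s n) / (1 - n / s n) ^ 2 * (1 - n / s n)) atTop
      (𝓝 0) := by
    have := hA.mul (hq.const_sub 1)
    simpa using this
  refine tendsto_of_tendsto_of_tendsto_of_le_of_le'
    (g := fun n : ℕ => Real.exp (-((∑ k ∈ Finset.range n, poissonCDF k (s n)) /
      (1 - poissonMass n (s n) / (1 - n / s n) ^ 2 * (1 - n / s n)))))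
    (h := fun n : ℕ => Real.exp (-∑ k ∈ Finset.range n, poissonCDF k (s n))) ?_ ?_ ?_ ?_
  · have := (hS.div (hQ.const_sub 1) (by norm_num)).neg
    rw [sub_zero, div_one] at this
    exact (Real.continuous_exp.tendsto _).comp this
  · exact (Real.continuous_exp.tendsto _).comp hS.neg
  · filter_upwards [hs, eventually_ne_atTop 0, hQ.eventually_lt_const one_pos] with n h1 h2 h3
    have hs0 : 0 ≤ s n := le_trans (Nat.cast_nonneg n) h1.le
    refine exp_le_prod_one_sub _ _ h3 (fun k _ => poissonCDF_nonneg k hs0) fun k hk => ?_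
    exact (poissonCDF_mono hs0 (Nat.le_sub_one_of_lt (Finset.mem_range.1 hk))).trans
      (poissonCDF_pred_le h1 h2)
  · filter_upwards [hs] with n h1
    have hs0 : 0 ≤ s n := le_trans (Nat.cast_nonneg n) h1.le
    exact prod_one_sub_le_exp _ _ fun k _ => poissonCDF_le_one k hs0

/-! ### Asymptotics at the Gumbel scale. -/

lemma tendsto_edgeC_div_log : Tendsto (fun n : ℕ => edgeC n / Real.log n) atTop (𝓝 1) := by
  have h1 : Tendsto (fun x : ℝ => (x - 2 * Real.log x - Real.log (2 * Real.pi)) / x) atTop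
      (𝓝 1) := by
    have h2 : Tendsto (fun x : ℝ => Real.log x / x) atTop (𝓝 0) :=
      Real.isLittleO_log_id_atTop.tendsto_div_nhds_zero
    have h3 : Tendsto (fun x : ℝ => Real.log (2 * Real.pi) / x) atTop (𝓝 0) :=
      tendsto_id.const_div_atTop _
    have h4 := ((h2.const_mul 2).const_sub 1).sub h3
    rw [mul_zero, sub_zero, sub_zero] at h4
    refine h4.congr' ?_
    filter_upwards [eventually_ne_atTop 0] with x hx
    field_simp
  exact h1.comp (Real.tendsto_log_atTop.comp tendsto_natCast_atTop_atTop)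

lemma tendsto_edgeC : Tendsto edgeC atTop atTop := by
  have hL : Tendsto (fun n : ℕ => Real.log n) atTop atTop :=
    Real.tendsto_log_atTop.comp tendsto_natCast_atTop_atTop
  refine (tendsto_edgeC_div_log.pos_mul_atTop one_pos hL).congr' ?_
  filter_upwards [hL.eventually_ne_atTop 0] with n hn
  exact div_mul_cancel₀ _ hn

lemma tendsto_edgeC_pow_div (m : ℕ) : Tendsto (fun n : ℕ => edgeC n ^ m / n) atTop (𝓝 0) := by
  have hL : Tendsto (fun n : ℕ => Real.log n) atTop atTop :=
    Real.tendsto_log_atTop.comp tendsto_natCast_atTop_atTop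
  have h1 : Tendsto (fun n : ℕ => Real.log n ^ m / n) atTop (𝓝 0) :=
    (Real.isLittleO_pow_log_id_atTop (n := m)).tendsto_div_nhds_zero.comp tendsto_natCast_atTop_atTop
  have h2 := (tendsto_edgeC_div_log.pow m).mul h1
  rw [mul_zero] at h2
  refine h2.congr' ?_
  filter_upwards [hL.eventually_ne_atTop 0] with n hn
  rw [← mul_div_assoc, ← mul_pow, div_mul_cancel₀ _ hn]

/-- The relative displacement from the edge at the level `t` of the Gumbel scaling. -/
def edgeShift (t : ℝ) (n : ℕ) : ℝ := 1 / 2 * √(edgeC n / n) + t / (2 * √(n * edgeC n))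

lemma edgeShift_eq (t : ℝ) {n : ℕ} (hn : n ≠ 0) (hc : 0 < edgeC n) :
    edgeShift t n = (edgeC n + t) / (2 * √(n * edgeC n)) := by
  have hn0 : (0 : ℝ) < n := by exact_mod_cast Nat.pos_of_ne_zero hn
  unfold edgeShift
  have h : √(edgeC n / n) = edgeC n / √(n * edgeC n) := by
    rw [Real.sqrt_div hc.le, Real.sqrt_mul hn0.le, div_eq_div_iff (by positivity) (by positivity)]
    linear_combination √n * Real.mul_self_sqrt hc.le
  rw [h]
  field_simp

lemma tendsto_edgeShift_mul (t : ℝ) :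
    Tendsto (fun n : ℕ => edgeC n * edgeShift t n) atTop (𝓝 0) := by
  have h1 : Tendsto (fun n : ℕ => (1 + t / edgeC n) / 2 * √(edgeC n ^ 3 / n)) atTop (𝓝 0) := by
    have h2 := ((tendsto_edgeC.const_div_atTop t).const_add 1).div_const 2
    have h3 := h2.mul (tendsto_edgeC_pow_div 3).sqrt
    simpa using h3
  refine h1.congr' ?_
  filter_upwards [tendsto_edgeC.eventually_gt_atTop 0, eventually_ne_atTop 0] with n hc hn
  have hn0 : (0 : ℝ) < n := by exact_mod_cast Nat.pos_of_ne_zero hn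
  have h : √(edgeC n ^ 3 / n) = edgeC n ^ 2 / √(n * edgeC n) := by
    rw [show edgeC n ^ 3 / n = (edgeC n ^ 2) ^ 2 / (n * edgeC n) by field_simp,
      Real.sqrt_div (by positivity), Real.sqrt_sq (by positivity)]
  rw [edgeShift_eq t hn hc, h]
  field_simp

lemma tendsto_edgeShift (t : ℝ) : Tendsto (edgeShift t) atTop (𝓝 0) := by
  have h := (tendsto_edgeC.const_div_atTop 1).mul (tendsto_edgeShift_mul t)
  rw [mul_zero] at h
  refine h.congr' ?_
  filter_upwards [tendsto_edgeC.eventually_gt_atTop 0] with n hc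
  field_simp

lemma eventually_edgeShift_pos (t : ℝ) : ∀ᶠ n : ℕ in atTop, 0 < edgeShift t n := by
  filter_upwards [tendsto_edgeC.eventually_gt_atTop 0, eventually_ne_atTop 0,
    tendsto_edgeC.eventually_gt_atTop (-t)] with n hc hn ht
  have hn0 : (0 : ℝ) < n := by exact_mod_cast Nat.pos_of_ne_zero hn
  rw [edgeShift_eq t hn hc]
  have : 0 < edgeC n + t := by linarith
  positivity

/-- The shift is `(c + t) / (2 √(n c))`, and `(c + t)² / c = c + 2t + t² / c`. -/
lemma tendsto_nat_mul_edgeShift_sq (t : ℝ) :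
    Tendsto (fun n : ℕ => 4 * (n * edgeShift t n ^ 2) - edgeC n) atTop (𝓝 (2 * t)) := by
  have h := (tendsto_edgeC.const_div_atTop (t ^ 2)).const_add (2 * t)
  rw [add_zero] at h
  refine h.congr' ?_
  filter_upwards [tendsto_edgeC.eventually_gt_atTop 0, eventually_ne_atTop 0] with n hc hn
  have hn0 : (0 : ℝ) < n := by exact_mod_cast Nat.pos_of_ne_zero hn
  rw [edgeShift_eq t hn hc, div_pow, mul_pow, Real.sq_sqrt (by positivity)]
  field_simp
  ring

/-- The squared relative displacement `(1 + u)² - 1`. -/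
def edgeExcess (t : ℝ) (n : ℕ) : ℝ := (1 + edgeShift t n) ^ 2 - 1

lemma tendsto_edgeExcess (t : ℝ) : Tendsto (edgeExcess t) atTop (𝓝 0) := by
  have := (((tendsto_edgeShift t).const_add 1).pow 2).sub_const 1
  rw [add_zero, one_pow, sub_self] at this
  exact this

lemma eventually_edgeExcess_pos (t : ℝ) : ∀ᶠ n : ℕ in atTop, 0 < edgeExcess t n := by
  filter_upwards [eventually_edgeShift_pos t] with n hn
  unfold edgeExcess
  nlinarith

lemma tendsto_nat_mul_edgeShift_cube (t : ℝ) :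
    Tendsto (fun n : ℕ => n * edgeShift t n ^ 3) atTop (𝓝 0) := by
  -- With `u` the shift, `4 n u³ = (4 n u² - c) u + c u`, and both terms vanish in the limit.
  have h := (((tendsto_nat_mul_edgeShift_sq t).mul (tendsto_edgeShift t)).add
    (tendsto_edgeShift_mul t)).div_const 4
  rw [mul_zero, add_zero, zero_div] at h
  refine h.congr fun n => ?_
  ring

lemma tendsto_nat_mul_edgeExcess_sq (t : ℝ) :
    Tendsto (fun n : ℕ => n * edgeExcess t n ^ 2 - edgeC n) atTop (𝓝 (2 * t)) := by
  -- The excess is `2u + u²`, whose square is `4u² + u³ (4 + u)`.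
  have h := (tendsto_nat_mul_edgeShift_sq t).add ((tendsto_nat_mul_edgeShift_cube t).mul
    ((tendsto_edgeShift t).const_add 4))
  rw [zero_mul, add_zero] at h
  refine h.congr fun n => ?_
  unfold edgeExcess
  ring

lemma tendsto_nat_mul_edgeExcess_cube (t : ℝ) :
    Tendsto (fun n : ℕ => n * edgeExcess t n ^ 3) atTop (𝓝 0) := by
  have h := (tendsto_nat_mul_edgeShift_cube t).mul (((tendsto_edgeShift t).const_add 2).pow 3)
  rw [zero_mul] at h
  refine h.congr fun n => ?_
  unfold edgeExcess
  ring

lemma tendsto_nat_mul_edgeExcess_sq_atTop (t : ℝ) :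
    Tendsto (fun n : ℕ => n * edgeExcess t n ^ 2) atTop atTop := by
  refine ((tendsto_nat_mul_edgeExcess_sq t).add_atTop tendsto_edgeC).congr fun n => ?_
  ring

lemma tendsto_log_div_nat_mul_edgeExcess_sq (t : ℝ) :
    Tendsto (fun n : ℕ => Real.log n / (n * edgeExcess t n ^ 2)) atTop (𝓝 1) := by
  have hL : Tendsto (fun n : ℕ => Real.log n) atTop atTop :=
    Real.tendsto_log_atTop.comp tendsto_natCast_atTop_atTop
  have h := ((((tendsto_nat_mul_edgeExcess_sq t).div_atTop hL).add
    tendsto_edgeC_div_log)).inv₀ (by norm_num)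
  rw [zero_add, inv_one] at h
  refine h.congr' ?_
  filter_upwards [hL.eventually_gt_atTop 0] with n hn
  rw [← add_div, sub_add_cancel, inv_div]

/-- Since `x - log (1 + x) = x² / 2 + O(x³)` and `n x³ → 0`, only the quadratic term survives, and
half of `2t` is `t`. -/
lemma tendsto_large_deviation_exponent (t : ℝ) :
    Tendsto (fun n : ℕ => n * (edgeExcess t n - Real.log (1 + edgeExcess t n)) - edgeC n / 2)
      atTop (𝓝 t) := by
  have herr : Tendsto (fun n : ℕ => n * (Real.log (1 + edgeExcess t n) - edgeExcess t n +
      edgeExcess t n ^ 2 / 2)) atTop (𝓝 0) := by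
    have hb := (tendsto_nat_mul_edgeExcess_cube t).mul
      (((tendsto_edgeExcess t).const_sub 1).inv₀ (by norm_num))
    rw [zero_mul] at hb
    refine squeeze_zero_norm' ?_ hb
    filter_upwards [eventually_edgeExcess_pos t,
      (tendsto_edgeExcess t).eventually_lt_const one_pos] with n h0 h1
    have h := Real.abs_log_sub_add_sum_range_le (x := -edgeExcess t n)
      (by rwa [abs_neg, abs_of_pos h0]) 2
    rw [abs_neg, abs_of_pos h0] at h
    simp only [Finset.sum_range_succ, Finset.sum_range_zero] at h
    rw [norm_mul, Real.norm_natCast, Real.norm_eq_abs]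
    have h2 : Real.log (1 + edgeExcess t n) - edgeExcess t n + edgeExcess t n ^ 2 / 2 =
        0 + (-edgeExcess t n) ^ (0 + 1) / (((0 : ℕ) : ℝ) + 1) +
          (-edgeExcess t n) ^ (1 + 1) / (((1 : ℕ) : ℝ) + 1) + Real.log (1 - -edgeExcess t n) := by
      rw [sub_neg_eq_add]
      push_cast
      ring
    rw [h2, mul_assoc, ← div_eq_mul_inv]
    exact mul_le_mul_of_nonneg_left h (Nat.cast_nonneg n)
  have h := ((tendsto_nat_mul_edgeExcess_sq t).div_const 2).sub herr
  rw [sub_zero, mul_div_cancel_left₀ _ two_ne_zero] at h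
  refine h.congr fun n => ?_
  ring

lemma poissonMass_eq_stirling {n : ℕ} (hn : n ≠ 0) {x : ℝ} (hx : -1 < x) :
    poissonMass n (n * (1 + x)) =
      Real.exp (-(n * (x - Real.log (1 + x)))) / (√(2 * n) * Stirling.stirlingSeq n) := by
  have hn0 : (0 : ℝ) < n := by exact_mod_cast Nat.pos_of_ne_zero hn
  have hx0 : 0 < 1 + x := by linarith
  have hf : (0 : ℝ) < n.factorial := by exact_mod_cast n.factorial_pos
  have h1 : Real.exp (-(n * (x - Real.log (1 + x)))) =
      Real.exp (-(n * (1 + x))) * (Real.exp 1 ^ n * (1 + x) ^ n) := by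
    have : (1 + x) ^ n = Real.exp (n * Real.log (1 + x)) := by
      rw [Real.exp_nat_mul, Real.exp_log hx0]
    rw [this, ← Real.exp_nat_mul, ← Real.exp_add, ← Real.exp_add]
    congr 1
    ring
  unfold poissonMass Stirling.stirlingSeq
  have hs : (0 : ℝ) < √(2 * n) := by positivity
  rw [h1, mul_pow, div_pow]
  field_simp

/-- This accounts for the form of `c_n`: `√(2π)` cancels the Stirling constant, and `log n / √n`
balances the remaining `√n / (n x²)`, as `n x²` is asymptotic to `log n`. -/
lemma exp_neg_edgeC_div_two {n : ℕ} (hn : 1 < n) :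
    Real.exp (-(edgeC n / 2)) = Real.log n * √(2 * Real.pi) / √n := by
  have hn0 : (0 : ℝ) < n := by exact_mod_cast (by lia : 0 < n)
  have hL : 0 < Real.log n := Real.log_pos (by exact_mod_cast hn)
  have hpi := Real.two_pi_pos
  have : -(edgeC n / 2) =
      Real.log (Real.log n) + Real.log (2 * Real.pi) / 2 - Real.log n / 2 := by
    unfold edgeC; ring
  rw [this, Real.exp_sub, Real.exp_add, Real.exp_log hL, ← Real.log_sqrt hpi.le,
    ← Real.log_sqrt hn0.le, Real.exp_log (by positivity), Real.exp_log (by positivity)]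

lemma tendsto_prod_one_sub_poissonCDF_edge (t : ℝ) :
    Tendsto (fun n : ℕ => ∏ k ∈ Finset.range n,
      (1 - poissonCDF k (n * (1 + edgeShift t n) ^ 2))) atTop
      (𝓝 (Real.exp (-Real.exp (-t)))) := by
  have hs : ∀ n : ℕ, (n : ℝ) * (1 + edgeShift t n) ^ 2 = n * (1 + edgeExcess t n) := fun n => by
    unfold edgeExcess; ring
  simp_rw [hs]
  have hq : ∀ᶠ n : ℕ in atTop, (n : ℝ) / (n * (1 + edgeExcess t n)) = (1 + edgeExcess t n)⁻¹ := by
    filter_upwards [eventually_ne_atTop 0] with n hn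
    have hn0 : (n : ℝ) ≠ 0 := by exact_mod_cast hn
    rw [← div_div, div_self hn0, one_div]
  have h1q : ∀ᶠ n : ℕ in atTop, 1 - (n : ℝ) / (n * (1 + edgeExcess t n)) =
      edgeExcess t n / (1 + edgeExcess t n) := by
    filter_upwards [hq, eventually_edgeExcess_pos t] with n h1 h2
    rw [h1]
    field_simp
    ring
  refine tendsto_prod_one_sub_poissonCDF ?_ ?_ ?_ ?_
  · filter_upwards [eventually_edgeExcess_pos t, eventually_gt_atTop 0] with n h1 h2
    have : (0 : ℝ) < n := by exact_mod_cast h2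
    nlinarith
  -- The quantity factors exactly into four pieces, with limits `e^{-t}`, `1`, `1`, `1`: the
  -- exponential, `log n / (n x²)`, the Stirling ratio and `(1 + x)²`.
  · have hE := (Real.continuous_exp.tendsto _).comp (tendsto_large_deviation_exponent t).neg
    have hσ := (tendsto_const_nhds (x := √Real.pi)).div
      Stirling.tendsto_stirlingSeq_sqrt_pi (Real.sqrt_pos.2 Real.pi_pos).ne'
    have h := ((hE.mul (tendsto_log_div_nat_mul_edgeExcess_sq t)).mul hσ).mul
      (((tendsto_edgeExcess t).const_add 1).pow 2)
    rw [div_self (Real.sqrt_pos.2 Real.pi_pos).ne', mul_one, mul_one, add_zero, one_pow,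
      mul_one] at h
    refine h.congr' ?_
    filter_upwards [eventually_gt_atTop 1, eventually_edgeExcess_pos t, h1q] with n hn hx hq
    have hn0 : (0 : ℝ) < n := by exact_mod_cast (by lia : 0 < n)
    have hσ0 : 0 < Stirling.stirlingSeq n := by
      obtain ⟨m, rfl⟩ : ∃ m, n = m + 1 := ⟨n - 1, by lia⟩
      exact Stirling.stirlingSeq'_pos m
    have he : Real.exp (-(n * (edgeExcess t n - Real.log (1 + edgeExcess t n)))) =
        Real.exp (-(n * (edgeExcess t n - Real.log (1 + edgeExcess t n)) - edgeC n / 2)) *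
          (Real.log n * √(2 * Real.pi) / √n) := by
      rw [← exp_neg_edgeC_div_two hn, ← Real.exp_add]
      congr 1
      ring
    rw [hq, poissonMass_eq_stirling (by lia) (by linarith), he, Real.sqrt_mul zero_le_two,
      Real.sqrt_mul zero_le_two]
    simp only [Function.comp_apply, Pi.div_apply]
    have h2 : 0 < √(2 : ℝ) := by positivity
    have h3 : √(n : ℝ) ^ 2 = n := Real.sq_sqrt hn0.le
    have h4 : 0 < √(n : ℝ) := by positivity
    have h5 : 0 < 1 + edgeExcess t n := by linarith
    field_simp
    rw [h3, mul_comm]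
  · have h := ((tendsto_edgeExcess t).const_add 1).inv₀ (by norm_num)
    rw [add_zero, inv_one] at h
    exact h.congr' (hq.mono fun n hn => hn.symm)
  · have h := ((tendsto_edgeExcess t).const_add 1).inv₀ (by norm_num)
    rw [add_zero, inv_one] at h
    refine ((h.pow 2).pos_mul_atTop (by norm_num)
      (tendsto_nat_mul_edgeExcess_sq_atTop t)).congr' ?_
    filter_upwards [h1q] with n hn
    rw [hn]
    ring

/-! ### The normalising product tends to one. -/

/-- A Chernoff bound: since `α / n ≥ 1` and `j ≤ n`, replacing `α ^ j` by `(α / n) ^ n * n ^ j`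
leaves a partial sum of `e ^ n`. -/
lemma poissonCDF_le_exp {n k : ℕ} (hk : k < n) {α : ℝ} (hα : (n : ℝ) < α) :
    poissonCDF k α ≤ Real.exp (-(n * (α / n - 1 - Real.log (α / n)))) := by
  have hn0 : (0 : ℝ) < n := by exact_mod_cast (by lia : 0 < n)
  have hα0 : 0 < α := hn0.trans hα
  have hμ : 1 ≤ α / n := (one_le_div hn0).2 hα.le
  have h1 : Real.exp (-(n * (α / n - 1 - Real.log (α / n)))) =
      Real.exp (-α) * ((α / n) ^ n * Real.exp n) := by
    have : (α / n) ^ n = Real.exp (n * Real.log (α / n)) := by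
      rw [Real.exp_nat_mul, Real.exp_log (by positivity)]
    rw [this, ← Real.exp_add, ← Real.exp_add]
    congr 1
    field_simp
    ring
  rw [h1]
  refine mul_le_mul_of_nonneg_left ?_ (Real.exp_pos _).le
  refine le_trans ?_ (mul_le_mul_of_nonneg_left
    (Real.sum_le_exp_of_nonneg hn0.le (k + 1)) (by positivity))
  rw [Finset.mul_sum]
  refine Finset.sum_le_sum fun j hj => ?_
  have h2 : α ^ j / j.factorial = (α / n) ^ j * ((n : ℝ) ^ j / j.factorial) := by
    rw [div_pow]
    field_simp
  rw [h2]
  refine mul_le_mul_of_nonneg_right (pow_le_pow_right₀ hμ ?_) (by positivity)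
  have := Finset.mem_range.1 hj
  lia

lemma outerMass_le_exp {n k : ℕ} (hk : k < n) {α : ℝ} (hα : (n : ℝ) < α) :
    outerMass k α ≤
      Real.exp (-(n * (α / n - 1 - Real.log (α / n)))) * (α / n / (α / n - 1)) := by
  have hn0 : (0 : ℝ) < n := by exact_mod_cast (by lia : 0 < n)
  have hα0 : 0 < α := hn0.trans hα
  have hkn : (k : ℝ) + 1 ≤ n := by exact_mod_cast hk
  have h1 : poissonMass k α ≤ poissonCDF k α := by
    rw [poissonCDF_eq_sum]
    exact Finset.single_le_sum (f := fun j => poissonMass j α)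
      (fun j _ => poissonMass_nonneg j hα0.le) (Finset.self_mem_range_succ k)
  -- The outer mass is a single Poisson mass times a factor bounded uniformly over `k < n`.
  have h2 : outerMass k α = poissonMass k α * (α / (α - k - 1)) := by
    unfold outerMass poissonMass
    rw [pow_succ, mul_assoc]
    congr 1
    rw [div_mul_div_comm]
  have h3 : α / n / (α / n - 1) = α / (α - n) := by
    have : α - n ≠ 0 := by linarith
    have : α / n - 1 = (α - n) / n := by field_simp
    rw [this]
    field_simp
  rw [h2, h3]
  have h4 : α / (α - k - 1) ≤ α / (α - n) :=
    div_le_div_of_nonneg_left hα0.le (by linarith) (by linarith)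
  exact mul_le_mul (h1.trans (poissonCDF_le_exp hk hα)) h4
    (div_nonneg hα0.le (by linarith)) (Real.exp_pos _).le

lemma tendsto_prod_one_add_of_nat_mul {e : ℕ → ℕ → ℝ} {ε : ℕ → ℝ}
    (he : ∀ᶠ n in atTop, ∀ k < n, |e n k| ≤ ε n)
    (hε : Tendsto (fun n : ℕ => n * ε n) atTop (𝓝 0)) :
    Tendsto (fun n => ∏ k ∈ Finset.range n, (1 + e n k)) atTop (𝓝 1) := by
  have h1 := hε.const_sub 1
  have h2 := (Real.continuous_exp.tendsto _).comp hε
  rw [sub_zero] at h1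
  rw [Real.exp_zero] at h2
  have hsmall : ∀ᶠ n : ℕ in atTop, 0 ≤ ε n ∧ ε n ≤ 1 := by
    filter_upwards [he, hε.eventually_lt_const one_pos, eventually_gt_atTop 0] with n h1 h2 h3
    have h4 : 0 ≤ ε n := (abs_nonneg _).trans (h1 0 h3)
    have h5 : (1 : ℝ) ≤ n := by exact_mod_cast h3
    exact ⟨h4, by nlinarith⟩
  refine tendsto_of_tendsto_of_tendsto_of_le_of_le' h1 h2 ?_ ?_
  · filter_upwards [he, hsmall] with n h ⟨h0, h1⟩
    have hb := one_add_mul_le_pow (a := -ε n) (by linarith) n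
    calc 1 - n * ε n ≤ (1 + -ε n) ^ n := by linarith
      _ = ∏ k ∈ Finset.range n, (1 + -ε n) := by rw [Finset.prod_const, Finset.card_range]
      _ ≤ _ := Finset.prod_le_prod (fun _ _ => by linarith) fun k hk => by
        linarith [neg_le_of_abs_le (h k (Finset.mem_range.1 hk))]
  · filter_upwards [he, hsmall] with n h ⟨h0, h1⟩
    simp only [Function.comp_apply]
    rw [Real.exp_nat_mul]
    calc ∏ k ∈ Finset.range n, (1 + e n k) ≤ ∏ k ∈ Finset.range n, Real.exp (ε n) :=
          Finset.prod_le_prod (fun k hk => by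
            linarith [neg_le_of_abs_le (h k (Finset.mem_range.1 hk))]) fun k hk => by
            linarith [le_of_abs_le (h k (Finset.mem_range.1 hk)), Real.add_one_le_exp (ε n)]
      _ = _ := by rw [Finset.prod_const, Finset.card_range]

lemma tendsto_nat_mul_exp_neg {g : ℕ → ℝ} {l : ℝ} (hl : 0 < l) (hg : Tendsto g atTop (𝓝 l)) :
    Tendsto (fun n : ℕ => n * Real.exp (-(n * g n))) atTop (𝓝 0) := by
  have h1 : Tendsto (fun x : ℝ => x ^ 1 * Real.exp (-(l / 2) * x)) atTop (𝓝 0) := by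
    have := tendsto_rpow_mul_exp_neg_mul_atTop_nhds_zero 1 (l / 2) (by positivity)
    simpa using this
  refine squeeze_zero' (Eventually.of_forall fun n => by positivity) ?_
    (h1.comp tendsto_natCast_atTop_atTop)
  filter_upwards [hg.eventually_const_le (by linarith : l / 2 < l)] with n hn
  simp only [Function.comp_apply, pow_one]
  gcongr
  nlinarith [(Nat.cast_nonneg n : (0 : ℝ) ≤ n)]

lemma tendsto_prod_normalisation {lam : ℝ} (hlam : 1 < lam) {α : ℕ → ℝ}
    (hα : Tendsto (fun n : ℕ => α n / n) atTop (𝓝 lam)) :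
    Tendsto (fun n : ℕ => ∏ k ∈ Finset.range n,
      (1 - poissonCDF k (α n) + outerMass k (α n))) atTop (𝓝 1) := by
  have hαn : ∀ᶠ n : ℕ in atTop, (n : ℝ) < α n := by
    filter_upwards [hα.eventually_const_lt hlam, eventually_gt_atTop 0] with n h1 h2
    rwa [one_lt_div (by exact_mod_cast h2)] at h1
  have hg : Tendsto (fun n : ℕ => α n / n - 1 - Real.log (α n / n)) atTop
      (𝓝 (lam - 1 - Real.log lam)) :=
    (hα.sub_const 1).sub (hα.log (by positivity))
  -- The strict inequality `λ > 1` gives a positive exponential rate, which beats the number `n` of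
  -- factors.
  have hg0 : 0 < lam - 1 - Real.log lam :=
    sub_pos.2 (Real.log_lt_sub_one_of_pos (by linarith) hlam.ne')
  have hr : Tendsto (fun n : ℕ => 1 + α n / n / (α n / n - 1)) atTop
      (𝓝 (1 + lam / (lam - 1))) :=
    (hα.div (hα.sub_const 1) (by linarith)).const_add 1
  have hε := (tendsto_nat_mul_exp_neg hg0 hg).mul hr
  rw [zero_mul] at hε
  simp_rw [mul_assoc] at hε
  have := tendsto_prod_one_add_of_nat_mul
    (e := fun n k => -poissonCDF k (α n) + outerMass k (α n)) ?_ hε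
  · refine this.congr fun n => Finset.prod_congr rfl fun k _ => by ring
  · filter_upwards [hαn] with n hn k hk
    have h0 : 0 ≤ α n := le_trans (Nat.cast_nonneg n) hn.le
    have hk1 : (k : ℝ) + 1 < α n := lt_of_le_of_lt (by exact_mod_cast hk) hn
    have h1 := poissonCDF_le_exp hk hn
    have h2 := outerMass_le_exp hk hn
    have h3 := poissonCDF_nonneg k h0
    have h4 := outerMass_pos hk1
    rw [mul_add, mul_one, abs_le]
    constructor <;> linarith

/-! ### Convergence in law and in probability. -/

/-- Pointwise convergence of distribution functions implies convergence in distribution. -/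
lemma tendstoInDistribution_of_tendsto_cdf {Ω : ℕ → Type*} [∀ n, MeasurableSpace (Ω n)]
    (P : ∀ n, Measure (Ω n)) [∀ n, IsProbabilityMeasure (P n)] (Y : ∀ n, Ω n → ℝ)
    (hY : ∀ n, AEMeasurable (Y n) (P n)) (ν : Measure ℝ) [IsProbabilityMeasure ν]
    (h : ∀ t, Tendsto (fun n => (P n).real {ω | Y n ω ≤ t}) atTop (𝓝 (ν.real (Set.Iic t)))) :
    TendstoInDistribution Y atTop (id : ℝ → ℝ) P ν := by
  refine ⟨hY, aemeasurable_id, ?_⟩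
  have hIoc : ∀ (μ : Measure ℝ) [IsProbabilityMeasure μ] {a b : ℝ}, a ≤ b →
      μ.real (Set.Ioc a b) = μ.real (Set.Iic b) - μ.real (Set.Iic a) := by
    intro μ _ a b hab
    rw [← Set.Iic_sdiff_Iic, measureReal_sdiff (Set.Iic_subset_Iic.2 hab) measurableSet_Iic]
  -- Half-open intervals form a π-system containing arbitrarily small neighbourhoods of every point;
  -- their masses are differences of distribution functions.
  refine IsPiSystem.tendsto_probabilityMeasure_of_tendsto_of_mem
    (isPiSystem_Ioc_mem Set.univ (Set.univ : Set ℝ)) ?_ ?_ ?_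
  · rintro _ ⟨a, -, b, -, -, rfl⟩
    exact measurableSet_Ioc
  · intro u hu x hx
    obtain ⟨ε, hε, hb⟩ := Metric.isOpen_iff.1 hu x hx
    refine ⟨Set.Ioc (x - ε / 2) (x + ε / 2), ⟨_, trivial, _, trivial, by linarith, rfl⟩,
      Ioc_mem_nhds (by linarith) (by linarith), fun y hy => hb ?_⟩
    rw [Metric.mem_ball, Real.dist_eq, abs_lt]
    constructor <;> linarith [hy.1, hy.2]
  · rintro _ ⟨a, -, b, -, hab, rfl⟩
    rw [← NNReal.tendsto_coe]
    change Tendsto (fun n => ((P n).map (Y n)).real (Set.Ioc a b)) atTop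
      (𝓝 ((ν.map id).real (Set.Ioc a b)))
    rw [Measure.map_id, hIoc ν hab.le]
    have : ∀ n, ((P n).map (Y n)).real (Set.Ioc a b) =
        (P n).real {ω | Y n ω ≤ b} - (P n).real {ω | Y n ω ≤ a} := by
      intro n
      have := Measure.isProbabilityMeasure_map (hY n)
      rw [hIoc _ hab.le, map_measureReal_apply_of_aemeasurable (hY n) measurableSet_Iic,
        map_measureReal_apply_of_aemeasurable (hY n) measurableSet_Iic]
      rfl
    simp_rw [this]
    exact (h b).sub (h a)

/-- The level `b_n + t / a_n`. -/
def edgeLevel (R : ℝ) (α : ℕ → ℝ) (t : ℝ) (n : ℕ) : ℝ :=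
  edgeRadius R (α n) n * (1 + edgeShift t n)

lemma tendsto_edgeLevel (R : ℝ) {lam : ℝ} (hlam : 1 < lam) {α : ℕ → ℝ}
    (hα : Tendsto (fun n : ℕ => α n / n) atTop (𝓝 lam)) (t : ℝ) :
    Tendsto (edgeLevel R α t) atTop (𝓝 (R / √lam)) := by
  have h := ((hα.inv₀ (by linarith)).sqrt.mul_const R).mul ((tendsto_edgeShift t).const_add 1)
  simp_rw [inv_div] at h
  rw [add_zero, mul_one, Real.sqrt_inv, inv_mul_eq_div] at h
  exact h

lemma edgeScale_mul_sub_le_iff {R : ℝ} (hR : 0 < R) {α : ℕ → ℝ} {n : ℕ} (hn : n ≠ 0)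
    (hα : 0 < α n) (hc : 0 < edgeC n) (t M : ℝ) :
    edgeScale R (α n) n * (M - edgeCenter R (α n) n) ≤ t ↔ M ≤ edgeLevel R α t n := by
  have hn0 : (0 : ℝ) < n := by exact_mod_cast Nat.pos_of_ne_zero hn
  have hC : 0 < edgeRadius R (α n) n := by unfold edgeRadius; positivity
  have ha : 0 < edgeScale R (α n) n := by unfold edgeScale; positivity
  have hlevel : edgeLevel R α t n = t / edgeScale R (α n) n + edgeCenter R (α n) n := by
    unfold edgeLevel edgeScale edgeCenter edgeShift
    field_simp
    ring
  rw [hlevel, ← sub_le_iff_le_add, le_div_iff₀' ha]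

lemma tendsto_coulombGas_edge {R : ℝ} (hR : 0 < R) {lam : ℝ} (hlam : 1 < lam) {α : ℕ → ℝ}
    (hα : Tendsto (fun n : ℕ => α n / n) atTop (𝓝 lam)) (t : ℝ) :
    Tendsto (fun n : ℕ => (coulombGas 2 n (jelliumPotential R (α n) n)).real
      {x | maxModulus x ≤ edgeLevel R α t n}) atTop (𝓝 (Real.exp (-Real.exp (-t)))) := by
  have hlim : R / √lam < R := by
    rw [div_lt_iff₀ (by positivity)]
    have : 1 < √lam := by rwa [Real.lt_sqrt zero_le_one, one_pow]
    nlinarith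
  have h := (tendsto_prod_one_sub_poissonCDF_edge t).div (tendsto_prod_normalisation hlam hα)
    one_ne_zero
  rw [div_one] at h
  refine h.congr' ?_
  filter_upwards [hα.eventually_const_lt hlam, eventually_ne_atTop 0, eventually_edgeShift_pos t,
    (tendsto_edgeLevel R hlam hα t).eventually_le_const hlim] with n h1 hn hu hr
  have hn0 : (0 : ℝ) < n := by exact_mod_cast Nat.pos_of_ne_zero hn
  rw [one_lt_div hn0] at h1
  have hα0 : 0 < α n := hn0.trans h1
  have hr0 : 0 ≤ edgeLevel R α t n := by unfold edgeLevel edgeRadius; positivity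
  -- The radius `R √(n / α)` is the one for which the Gamma parameter becomes `n (1 + u)²`, free of
  -- `R` and `α`.
  have hs : α n / R ^ 2 * edgeLevel R α t n ^ 2 = n * (1 + edgeShift t n) ^ 2 := by
    unfold edgeLevel edgeRadius
    rw [mul_pow, mul_pow, Real.sq_sqrt (by positivity)]
    field_simp
  rw [measureReal_def, coulombGas_maxModulus_le hR hn h1 hr0 hr, hs, ENNReal.toReal_ofReal]
  · rfl
  · refine div_nonneg (Finset.prod_nonneg fun k _ => ?_) (Finset.prod_nonneg fun k hk => ?_)
    · exact sub_nonneg.2 (poissonCDF_le_one k (by positivity))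
    · exact (one_sub_poissonCDF_add_outerMass_pos
        (lt_of_le_of_lt (by exact_mod_cast Finset.mem_range.1 hk) h1)).le

/-- Variables whose distribution functions at levels tending to `m` have Gumbel limits converge to
`m` in probability. -/
lemma tendsto_measure_abs_sub_of_gumbel {Ω : ℕ → Type*} [∀ n, MeasurableSpace (Ω n)]
    (P : ∀ n, Measure (Ω n)) [∀ n, IsProbabilityMeasure (P n)] (Y : ∀ n, Ω n → ℝ)
    (hY : ∀ n, AEMeasurable (Y n) (P n)) {r : ℝ → ℕ → ℝ} {m : ℝ}
    (hr : ∀ t, Tendsto (r t) atTop (𝓝 m))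
    (h : ∀ t, Tendsto (fun n => (P n).real {ω | Y n ω ≤ r t n}) atTop
      (𝓝 (Real.exp (-Real.exp (-t))))) {ε : ℝ} (hε : 0 < ε) :
    Tendsto (fun n => P n {ω | ε ≤ |Y n ω - m|}) atTop (𝓝 0) := by
  suffices hreal : Tendsto (fun n => (P n).real {ω | ε ≤ |Y n ω - m|}) atTop (𝓝 0) by
    refine (ENNReal.tendsto_toReal_iff (fun n => measure_ne_top _ _) ENNReal.zero_ne_top).1 ?_
    simpa only [measureReal_def, ENNReal.toReal_zero] using hreal
  have hG : Tendsto (fun T : ℝ => gumbelCDF (-T) + (1 - gumbelCDF T)) atTop (𝓝 0) := by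
    have := (tendsto_gumbelCDF_atBot.comp tendsto_neg_atTop_atBot).add
      (tendsto_gumbelCDF_atTop.const_sub 1)
    simpa using this
  refine tendsto_order.2 ⟨fun a ha => Eventually.of_forall fun n =>
    ha.trans_le measureReal_nonneg, fun δ hδ => ?_⟩
  -- `T` leaves Gumbel mass less than `δ` outside `(-T, T]`. The levels at `±T` both tend to `m`, so
  -- a deviation by `ε` eventually forces the variable outside them.
  obtain ⟨T, hT⟩ := (hG.eventually_lt_const hδ).exists
  have hlim := (h (-T)).add ((h T).const_sub 1)
  filter_upwards [hlim.eventually_lt_const hT,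
    (hr (-T)).eventually_const_lt (by linarith : m - ε < m),
    (hr T).eventually_lt_const (by linarith : m < m + ε)] with n h1 h2 h3
  refine lt_of_le_of_lt ?_ h1
  have hnull : NullMeasurableSet {ω | Y n ω ≤ r T n} (P n) :=
    nullMeasurableSet_le (hY n) aemeasurable_const
  have hcompl : (P n).real {ω | Y n ω ≤ r T n}ᶜ = 1 - (P n).real {ω | Y n ω ≤ r T n} := by
    rw [measureReal_compl₀ hnull, probReal_univ]
  rw [← hcompl]
  refine (measureReal_mono (fun ω hω => ?_)).trans (measureReal_union_le _ _)
  rcases le_abs.1 (show ε ≤ |Y n ω - m| from hω) with h4 | h4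
  · right
    simp only [Set.mem_compl_iff, Set.mem_ofPred_eq, not_le]
    linarith
  · left
    simp only [Set.mem_ofPred_eq]
    linarith

end Jellium

end

theorem theorem1p5 (R : ℝ) (hR : 0 < R) (lam : ℝ) (hlam : 1 < lam) (α : ℕ → ℝ)
    (hα : Tendsto (fun n : ℕ => α n / n) atTop (𝓝 lam)) :
    (∀ᶠ n : ℕ in atTop,
      Jellium.partitionFunction 2 n (Jellium.jelliumPotential R (α n) n) < ⊤ ∧
      IsProbabilityMeasure (Jellium.coulombGas 2 n (Jellium.jelliumPotential R (α n) n))) ∧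
    (∀ (Ω : ℕ → Type*) [∀ n, MeasurableSpace (Ω n)] (P : ∀ n, Measure (Ω n))
        [∀ n, IsProbabilityMeasure (P n)] (X : ∀ n, Ω n → Fin n → ℂ),
      (∀ n, AEMeasurable (X n) (P n)) →
      (∀ᶠ n : ℕ in atTop,
        HasLaw (X n) (Jellium.coulombGas 2 n (Jellium.jelliumPotential R (α n) n)) (P n)) →
      (∀ ε : ℝ, 0 < ε →
        Tendsto (fun n : ℕ => P n {ω | ε ≤ |Jellium.maxModulus (X n ω) - R / √lam|})
          atTop (𝓝 0)) ∧
      TendstoInDistribution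
        (fun (n : ℕ) (ω : Ω n) => Jellium.edgeScale R (α n) n *
          (Jellium.maxModulus (X n ω) - Jellium.edgeCenter R (α n) n))
        atTop (id : ℝ → ℝ) P Jellium.gumbelLaw) := by
  have hαn : ∀ᶠ n : ℕ in atTop, n ≠ 0 ∧ (n : ℝ) < α n := by
    filter_upwards [hα.eventually_const_lt hlam, eventually_ne_atTop 0] with n h1 h2
    exact ⟨h2, (one_lt_div (by exact_mod_cast Nat.pos_of_ne_zero h2)).1 h1⟩
  refine ⟨hαn.mono fun n h => ⟨Jellium.partitionFunction_jellium_lt_top hR h.1 h.2,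
    Jellium.isProbabilityMeasure_coulombGas hR h.1 h.2⟩, ?_⟩
  intro Ω _ P _ X hX hlaw
  have hM : ∀ n, AEMeasurable (fun ω => Jellium.maxModulus (X n ω)) (P n) := fun n =>
    (Jellium.measurable_maxModulus n).comp_aemeasurable (hX n)
  have hcdf : ∀ t, Tendsto (fun n => (P n).real
      {ω | Jellium.maxModulus (X n ω) ≤ Jellium.edgeLevel R α t n}) atTop
      (𝓝 (Real.exp (-Real.exp (-t)))) := by
    intro t
    refine (Jellium.tendsto_coulombGas_edge hR hlam hα t).congr' ?_
    filter_upwards [hlaw] with n hn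
    rw [← hn.map_eq]
    exact map_measureReal_apply_of_aemeasurable (hX n)
      (Jellium.measurable_maxModulus n measurableSet_Iic)
  refine ⟨fun ε hε => Jellium.tendsto_measure_abs_sub_of_gumbel P _ hM
    (Jellium.tendsto_edgeLevel R hlam hα) hcdf hε, ?_⟩
  refine Jellium.tendstoInDistribution_of_tendsto_cdf P _
    (fun n => ((hM n).sub_const _).const_mul _) _ fun t => ?_
  rw [measureReal_def, Jellium.gumbelLaw_Iic, ENNReal.toReal_ofReal (Real.exp_pos _).le]
  refine (hcdf t).congr' ?_
  -- Positivity of `c_n` makes the scale `a_n` positive, so the rescaled event is the event at the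
  -- edge level.
  filter_upwards [hαn, Jellium.tendsto_edgeC.eventually_gt_atTop 0] with n h1 hc
  simp_rw [Jellium.edgeScale_mul_sub_le_iff hR h1.1
    (lt_of_le_of_lt (Nat.cast_nonneg n) h1.2) hc]
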